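/- Let $n\ge 0$ be an integer and let $\mathcal P^n$ be the set of convex polytopes in $\mathbb R^n$, that is, convex hulls of non-empty finite sets of points, with the topology of the Hausdorff metric. A function $Z:\mathcal P^n\to\mathbb R$ is a valuation if $$Z(P)+Z(Q)=Z(P\cup Q)+Z(P\cap Q)$$ for all $P,Q\in\mathcal P^n$ with $P\cup Q\in\mathcal P^n$, where $Z(\varnothing):=0$. It is translation invariant if $Z(x+P)=Z(P)$ for all $x\in\mathbb R^n$ and $P\in\mathcal P^n$, and $\operatorname{SL}(n)$ invariant if $Z(\phi P)=Z(P)$ for all $\phi\in\operatorname{SL}(n)$ (the real $n\times n$ matrices of determinant $1$) and $P\in\mathcal P^n$. A Cauchy function is a function $\zeta:[0,\infty)\to\mathbb R$ with $\zeta(x+y)=\zeta(x)+\zeta(y)$ for all $x,y\in[0,\infty)$. Let $V_n$ be the $n$-dimensional volume and $V_0$ the zeroth intrinsic volume (the Euler characteristic), that is, the coefficient of $\kappa_n r^n$ in the Steiner polynomial $r\mapsto V_n(P+rB^n)$, where $B^n$ is the closed Euclidean unit ball and $\kappa_n=V_n(B^n)$; so $V_0(P)=\lim_{r\to\infty}V_n(P+rB^n)/(\kappa_n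 r^n)$. (1) A function $Z:\mathcal P^n\to\mathbb R$ is a translation and $\operatorname{SL}(n)$ invariant valuation if and only if there are a constant $c_0\in\mathbb R$ and a Cauchy function $\zeta:[0,\infty)\to\mathbb R$ such that $$Z(P)=c_0V_0(P)+\zeta(V_n(P))\quad\text{for every }P\in\mathcal P^n.$$ (2) A function $Z:\mathcal P^n\to\mathbb R$ is a continuous, translation and $\operatorname{SL}(n)$ invariant valuation if and only if there are constants $c_0,c_n\in\mathbb R$ such that $$Z(P)=c_0V_0(P)+c_nV_n(P)\quad\text{for every }P\in\mathcal P^n.$$ -/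

import Mathlib

open Filter MeasureTheory Topology
open scoped NNReal ENNReal Pointwise

/-- A convex polytope in `ℝⁿ`: the convex hull of finitely many (and at least one) points. -/
structure ConvexPolytope (n : ℕ) where
  carrier : Set (EuclideanSpace ℝ (Fin n))
  nonempty' : carrier.Nonempty
  isHull' : ∃ s : Set (EuclideanSpace ℝ (Fin n)), s.Finite ∧ carrier = convexHull ℝ s

namespace ConvexPolytope

variable {n : ℕ}

instance : SetLike (ConvexPolytope n) (EuclideanSpace ℝ (Fin n)) where
  coe := carrier
  coe_injective P Q h := by cases P; cases Q; congr

theorem nonempty (P : ConvexPolytope n) : (P : Set (EuclideanSpace ℝ (Fin n))).Nonempty :=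
  P.nonempty'

theorem isCompact (P : ConvexPolytope n) : IsCompact (P : Set (EuclideanSpace ℝ (Fin n))) := by
  obtain ⟨s, hs, h⟩ := P.isHull'
  change IsCompact P.carrier
  rw [h]
  exact hs.isCompact_convexHull (𝕜 := ℝ)

/-- The image of a convex polytope under an affine map. -/
def map (f : EuclideanSpace ℝ (Fin n) →ᵃ[ℝ] EuclideanSpace ℝ (Fin n)) (P : ConvexPolytope n) :
    ConvexPolytope n where
  carrier := f '' (P : Set (EuclideanSpace ℝ (Fin n)))
  nonempty' := P.nonempty.image f
  isHull' := by
    obtain ⟨s, hs, h⟩ := P.isHull'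
    refine ⟨f '' s, hs.image f, ?_⟩
    change f '' P.carrier = _
    rw [h, f.image_convexHull]

/-- The translate `x + P`. -/
noncomputable def translate (x : EuclideanSpace ℝ (Fin n)) (P : ConvexPolytope n) : ConvexPolytope n :=
  P.map (AffineEquiv.constVAdd ℝ (EuclideanSpace ℝ (Fin n)) x).toAffineMap

/-- The image `φ P` of `P` under `φ ∈ SL(n)`. -/
noncomputable def slImage (φ : Matrix.SpecialLinearGroup (Fin n) ℝ) (P : ConvexPolytope n) :
    ConvexPolytope n :=
  P.map (Matrix.toEuclideanLin (φ : Matrix (Fin n) (Fin n) ℝ)).toAffineMap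

theorem coe_translate (x : EuclideanSpace ℝ (Fin n)) (P : ConvexPolytope n) :
    (P.translate x : Set (EuclideanSpace ℝ (Fin n))) = (fun y => x + y) '' (P : Set _) := rfl

theorem coe_slImage (φ : Matrix.SpecialLinearGroup (Fin n) ℝ) (P : ConvexPolytope n) :
    (P.slImage φ : Set (EuclideanSpace ℝ (Fin n))) =
      (fun y => Matrix.toEuclideanLin (φ : Matrix (Fin n) (Fin n) ℝ) y) '' (P : Set _) := rfl

/-- A convex polytope as a non-empty compact set. -/
def toNonemptyCompacts (P : ConvexPolytope n) :
    TopologicalSpace.NonemptyCompacts (EuclideanSpace ℝ (Fin n)) where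
  carrier := P
  isCompact' := P.isCompact
  nonempty' := P.nonempty

/-- The topology of the Hausdorff metric. -/
instance : TopologicalSpace (ConvexPolytope n) :=
  TopologicalSpace.induced toNonemptyCompacts inferInstance

/-- The `n`-dimensional volume `V_n`, i.e. Lebesgue measure (finite, by compactness). -/
noncomputable def vol (P : ConvexPolytope n) : ℝ≥0 :=
  (volume (P : Set (EuclideanSpace ℝ (Fin n)))).toNNReal

/-- The zeroth intrinsic volume `V_0`, i.e. the coefficient of `κ_n r ^ n` in the Steiner polynomial
`V_n (P + r B)` (with `B` the unit ball and `κ_n` its volume), extracted as the limit of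
`V_n (P + r B) / (κ_n r ^ n)` as `r → ∞`. The limit exists by `tendsto_steiner`. -/
noncomputable def eulerChar (P : ConvexPolytope n) : ℝ :=
  limUnder atTop fun r : ℝ =>
    volume.real ((P : Set (EuclideanSpace ℝ (Fin n))) + Metric.closedBall 0 r) /
      (volume.real (Metric.closedBall (0 : EuclideanSpace ℝ (Fin n)) 1) * r ^ n)

theorem tendsto_steiner (P : ConvexPolytope n) :
    Tendsto (fun r : ℝ =>
      volume.real ((P : Set (EuclideanSpace ℝ (Fin n))) + Metric.closedBall 0 r) /
        (volume.real (Metric.closedBall (0 : EuclideanSpace ℝ (Fin n)) 1) * r ^ n))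
      atTop (𝓝 1) := by
  obtain ⟨x, hx⟩ := P.nonempty
  obtain ⟨R, hR0, hR⟩ := P.isCompact.isBounded.subset_closedBall_lt 0 (0 : EuclideanSpace ℝ (Fin n))
  set κ := volume.real (Metric.closedBall (0 : EuclideanSpace ℝ (Fin n)) 1) with hκ
  have hκ0 : 0 < κ := ENNReal.toReal_pos
    (Metric.measure_closedBall_pos volume _ one_pos).ne' measure_closedBall_lt_top.ne
  have hball : ∀ (y : EuclideanSpace ℝ (Fin n)) (r : ℝ), 0 ≤ r →
      volume.real (Metric.closedBall y r) = κ * r ^ n := by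
    intro y r hr
    rw [hκ, Measure.real, Measure.real, Measure.addHaar_closedBall' _ _ hr, ENNReal.toReal_mul,
      ENNReal.toReal_ofReal (by positivity), finrank_euclideanSpace_fin, mul_comm]
  have hlim : Tendsto (fun r : ℝ => (1 + R * r⁻¹) ^ n) atTop (𝓝 1) := by
    simpa using ((tendsto_inv_atTop_zero.const_mul R).const_add 1).pow n
  refine tendsto_of_tendsto_of_tendsto_of_le_of_le' tendsto_const_nhds hlim ?_ ?_
  · filter_upwards [eventually_gt_atTop 0] with r hr
    rw [le_div_iff₀ (by positivity), one_mul, ← hball x r hr.le]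
    refine measureReal_mono ?_ (P.isCompact.add (isCompact_closedBall _ _)).measure_lt_top.ne
    intro y hy
    refine ⟨x, hx, y - x, ?_, by simp⟩
    simpa [dist_eq_norm] using hy
  · filter_upwards [eventually_gt_atTop 0] with r hr
    have h : κ * (R + r) ^ n = (1 + R * r⁻¹) ^ n * (κ * r ^ n) := by
      rw [show R + r = (1 + R * r⁻¹) * r by field_simp; ring, mul_pow]
      ring
    rw [div_le_iff₀ (by positivity), ← h, ← hball 0 (R + r) (by positivity)]
    refine measureReal_mono ?_ measure_closedBall_lt_top.ne
    rintro _ ⟨p, hp, q, hq, rfl⟩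
    have h1 := hR hp
    simp only [mem_closedBall_zero_iff] at h1 hq ⊢
    exact (norm_add_le p q).trans (add_le_add h1 hq)

/-- As expected of the Euler characteristic of a non-empty convex body, `V_0 P = 1`. -/
theorem eulerChar_eq_one (P : ConvexPolytope n) : P.eulerChar = 1 :=
  P.tendsto_steiner.limUnder_eq

/-- `Z(P) + Z(Q) = Z(P ∪ Q) + Z(P ∩ Q)` whenever `P`, `Q` and `P ∪ Q` are convex polytopes, with
the convention `Z(∅) = 0`: `U` stands for `P ∪ Q`, and `P ∩ Q` is either a convex polytope `I`
or empty. -/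
def IsValuation (Z : ConvexPolytope n → ℝ) : Prop :=
  (∀ P Q U I : ConvexPolytope n,
    (U : Set (EuclideanSpace ℝ (Fin n))) = (P : Set _) ∪ (Q : Set _) →
    (I : Set (EuclideanSpace ℝ (Fin n))) = (P : Set _) ∩ (Q : Set _) →
    Z P + Z Q = Z U + Z I) ∧
  (∀ P Q U : ConvexPolytope n,
    (U : Set (EuclideanSpace ℝ (Fin n))) = (P : Set _) ∪ (Q : Set _) →
    (P : Set (EuclideanSpace ℝ (Fin n))) ∩ (Q : Set _) = ∅ →
    Z P + Z Q = Z U)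

def IsTranslationInvariant (Z : ConvexPolytope n → ℝ) : Prop :=
  ∀ (x : EuclideanSpace ℝ (Fin n)) (P : ConvexPolytope n), Z (P.translate x) = Z P

def IsSLInvariant (Z : ConvexPolytope n → ℝ) : Prop :=
  ∀ (φ : Matrix.SpecialLinearGroup (Fin n) ℝ) (P : ConvexPolytope n), Z (P.slImage φ) = Z P

end ConvexPolytope

/-- A solution `ζ : [0, ∞) → ℝ` of the Cauchy functional equation. -/
def IsCauchyFunction (ζ : ℝ≥0 → ℝ) : Prop :=
  ∀ x y : ℝ≥0, ζ (x + y) = ζ x + ζ y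

/-! Subtract from `Z` its value at a point and set the result to `0` on `∅`. This gives a valuation
`W` that is invariant under volume-preserving affine maps and zero at points. It has to be shown
that `W` is a Cauchy function of the volume; since `V_0` is `1` on every polytope, the subtracted
constant becomes the term `c₀ V_0`.

On simplices, everything comes from cutting an edge. A lower-dimensional simplex has a spare
direction that can correct any determinant, so the two halves and the whole have the same value,
while the common face is zero by induction; hence the value is zero (`cornerSimplex_eq_zero`). A
full-dimensional simplex is determined by its volume up to equi-affine maps, and cutting it shows
that its value is additive in the volume (`axisSimplex_add`). This defines `ζ`.

The difference `W - ζ ∘ vol` is then a valuation that vanishes on all simplices, and it remains to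
see that such a valuation is zero (`IsPolytopeValuation.eq_zero`). Only unions of two polytopes with
convex union are available, so instead of a triangulation the proof goes by induction on dimension:
hyperplane arrangements through an interior point cut the polytope into cones over pieces of facets,
and coning off turns the valuation into one on a hyperplane.

With continuity, `ζ` tends to `0` at `0` by shrinking one polytope of positive volume to a point, so
`ζ` is linear. The converse needs additivity, invariance and Hausdorff continuity of the volume. -/

/-! ### Polytopes: sections by half-spaces and polar duality -/

/-- A (possibly empty) polytope: the convex hull of a finite set. -/
def IsPolytope {E : Type*} [AddCommGroup E] [Module ℝ E] (S : Set E) : Prop :=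
  ∃ t : Set E, t.Finite ∧ S = convexHull ℝ t

namespace IsPolytope

section Module

variable {E F : Type*} [AddCommGroup E] [Module ℝ E] [AddCommGroup F] [Module ℝ F]

theorem convex {S : Set E} (h : IsPolytope S) : Convex ℝ S := by
  obtain ⟨t, -, rfl⟩ := h
  exact convex_convexHull ℝ t

theorem singleton (x : E) : IsPolytope ({x} : Set E) := ⟨{x}, Set.finite_singleton x, by simp⟩

theorem of_finite {t : Set E} (h : t.Finite) : IsPolytope (convexHull ℝ t) := ⟨t, h, rfl⟩

theorem image {S : Set E} (h : IsPolytope S) (f : E →ᵃ[ℝ] F) : IsPolytope (f '' S) := by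
  obtain ⟨t, ht, rfl⟩ := h
  exact ⟨f '' t, ht.image f, f.image_convexHull t⟩

theorem hull_insert {S : Set E} (h : IsPolytope S) (p : E) : IsPolytope (convexHull ℝ (insert p S)) := by
  obtain ⟨t, ht, rfl⟩ := h
  refine ⟨insert p t, ht.insert p, ?_⟩
  rw [Set.insert_eq, convexHull_convexHull_union_right, ← Set.insert_eq]

/-- A polytope cut by a half-space is a polytope. -/
theorem inter_halfspace {S : Set E} (h : IsPolytope S) (f : E →ₗ[ℝ] ℝ) (c : ℝ) :
    IsPolytope (S ∩ {x | c ≤ f x}) := by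
  classical
  obtain ⟨t, ht, rfl⟩ := h
  lift t to Finset E using ht
  -- For `a` above and `b` below the level `c`, `z (a, b)` is the point where the segment from `a`
  -- to `b` meets the hyperplane `f = c`.
  set z : E × E → E := fun p =>
    ((f p.1 - c) + (c - f p.2))⁻¹ • ((c - f p.2) • p.1 + (f p.1 - c) • p.2) with hz
  set A := t.filter fun v => c ≤ f v with hA
  set B := t.filter fun v => ¬ c ≤ f v with hB
  have hT : ((A ∪ (A ×ˢ B).image z : Finset E) : Set E).Finite := Finset.finite_toSet _
  refine ⟨_, hT, ?_⟩
  apply Set.Subset.antisymm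
  · rintro x ⟨hx, hfx⟩
    simp only [Set.mem_ofPred_eq] at hfx
    obtain ⟨w, hw0, hw1, hwx⟩ := (Finset.mem_convexHull' (R := ℝ)).1 hx
    set C := convexHull ℝ ((A ∪ (A ×ˢ B).image z : Finset E) : Set E) with hC
    have hCc : Convex ℝ C := convex_convexHull ℝ _
    have hAC : ∀ a ∈ A, a ∈ C := fun a ha => subset_convexHull ℝ _ (by simp [ha])
    have hZC : ∀ a ∈ A, ∀ b ∈ B, z (a, b) ∈ C := fun a ha b hb =>
      subset_convexHull ℝ _ (by
        rw [Finset.mem_coe, Finset.mem_union, Finset.mem_image]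
        exact Or.inr ⟨(a, b), Finset.mem_product.2 ⟨ha, hb⟩, rfl⟩)
    have hA0 : ∀ a ∈ A, 0 ≤ w a := fun a ha => hw0 a (Finset.mem_filter.1 ha).1
    have hB0 : ∀ a ∈ B, 0 ≤ w a := fun a ha => hw0 a (Finset.mem_filter.1 ha).1
    have hAf : ∀ a ∈ A, 0 ≤ f a - c := fun a ha => sub_nonneg.2 (Finset.mem_filter.1 ha).2
    have hBf : ∀ a ∈ B, 0 < c - f a := fun a ha =>
      sub_pos.2 (not_le.1 (Finset.mem_filter.1 ha).2)
    set F := ∑ a ∈ A, w a * (f a - c) with hF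
    set G := ∑ b ∈ B, w b * (c - f b) with hG
    have hsum : ∑ a ∈ A, w a + ∑ b ∈ B, w b = 1 := by rw [Finset.sum_filter_add_sum_filter_not, hw1]
    have hxsum : ∑ a ∈ A, w a • a + ∑ b ∈ B, w b • b = x := by
      rw [Finset.sum_filter_add_sum_filter_not, hwx]
    have hFG : F - G = f x - c := by
      have h1 : ∑ v ∈ t, w v * (f v - c) = f x - c := by
        simp only [mul_sub, Finset.sum_sub_distrib, ← Finset.sum_mul, hw1, ← hwx, map_sum, map_smul,
          smul_eq_mul, one_mul]
      rw [← h1, ← Finset.sum_filter_add_sum_filter_not t (fun v => c ≤ f v), sub_eq_add_neg, hG,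
        ← Finset.sum_neg_distrib]
      congr 1
      exact Finset.sum_congr rfl fun b _ => by ring
    have hF0 : 0 ≤ F := Finset.sum_nonneg fun a ha => mul_nonneg (hA0 a ha) (hAf a ha)
    have hG0 : 0 ≤ G := Finset.sum_nonneg fun a ha => mul_nonneg (hB0 a ha) (hBf a ha).le
    -- `F` is the excess above the level, `G` the deficit below it, and `F - G = f x - c ≥ 0`. If `F
    -- = 0`, then `G = 0` and no weight lies on `B`.
    rcases hF0.eq_or_lt with hF1 | hF1
    · have hG1 : G = 0 := by linarith
      have hB1 : ∀ b ∈ B, w b = 0 := by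
        intro b hb
        have := (Finset.sum_eq_zero_iff_of_nonneg
          fun a ha => mul_nonneg (hB0 a ha) (hBf a ha).le).1 hG1 b hb
        exact (mul_eq_zero.1 this).resolve_right (hBf b hb).ne'
      rw [Finset.sum_eq_zero hB1, add_zero] at hsum
      rw [Finset.sum_eq_zero (s := B) fun b hb => by rw [hB1 b hb, zero_smul], add_zero] at hxsum
      rw [← hxsum]
      exact hCc.sum_mem hA0 hsum hAC
    · have hne : ∀ a ∈ A, ∀ b ∈ B, (f a - c) + (c - f b) ≠ 0 := fun a ha b hb =>
        (add_pos_of_nonneg_of_pos (hAf a ha) (hBf b hb)).ne'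
      -- Each `b` is balanced against all `a ∈ A` in proportion to their share of the excess `F`,
      -- which moves the pair to `z (a, b)`. This uses the fraction `G / F ≤ 1` of each `w a`; the
      -- rest stays at `a`, under the index `none`.
      set W : E × Option E → ℝ := fun p => p.2.elim (w p.1 * (1 - G / F))
        fun b => w p.1 * w b / F * ((f p.1 - c) + (c - f b)) with hW
      set Y : E × Option E → E := fun p => p.2.elim p.1 fun b => z (p.1, b) with hY
      have key := hCc.sum_mem (t := A ×ˢ Finset.insertNone B) (w := W) (z := Y) ?_ ?_ ?_
      · convert key using 1
        rw [Finset.sum_product, ← hxsum]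
        simp only [Finset.sum_insertNone, hW, hY, Option.elim_none, Option.elim_some]
        rw [Finset.sum_add_distrib]
        have h2 : ∑ a ∈ A, ∑ b ∈ B, (w a * w b / F * ((f a - c) + (c - f b))) • z (a, b) =
            ∑ a ∈ A, ∑ b ∈ B, ((w a * (w b * (c - f b)) / F) • a +
              ((w a * (f a - c)) * (w b / F)) • b) := by
          refine Finset.sum_congr rfl fun a ha => Finset.sum_congr rfl fun b hb => ?_
          rw [hz]
          simp only
          rw [smul_smul, mul_assoc, mul_inv_cancel₀ (hne a ha b hb), mul_one, smul_add, smul_smul,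
            smul_smul]
          congr 2 <;> ring
        rw [h2]
        simp only [Finset.sum_add_distrib]
        have h3 : ∑ a ∈ A, ∑ b ∈ B, (w a * (w b * (c - f b)) / F) • a =
            ∑ a ∈ A, (w a * (G / F)) • a := by
          refine Finset.sum_congr rfl fun a ha => ?_
          rw [← Finset.sum_smul, ← Finset.sum_div, ← Finset.mul_sum, mul_div_assoc]
        have h4 : ∑ a ∈ A, ∑ b ∈ B, (w a * (f a - c) * (w b / F)) • b = ∑ b ∈ B, w b • b := by
          rw [Finset.sum_comm]
          refine Finset.sum_congr rfl fun b hb => ?_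
          rw [← Finset.sum_smul, ← Finset.sum_mul, ← hF, mul_div_cancel₀ _ hF1.ne']
        rw [h3, h4, ← add_assoc, ← Finset.sum_add_distrib]
        congr 1
        refine Finset.sum_congr rfl fun a ha => ?_
        rw [← add_smul]
        congr 1
        ring
      · rintro ⟨a, o⟩ hp
        rw [Finset.mem_product] at hp
        have ha := hp.1
        cases o with
        | none =>
          have : G / F ≤ 1 := by rw [div_le_one hF1]; linarith
          exact mul_nonneg (hA0 a ha) (sub_nonneg.2 this)
        | some b =>
          have hb : b ∈ B := by simpa using hp.2
          exact mul_nonneg (div_nonneg (mul_nonneg (hA0 a ha) (hB0 b hb)) hF0)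
            (add_nonneg (hAf a ha) (hBf b hb).le)
      · rw [Finset.sum_product, ← hsum]
        simp only [Finset.sum_insertNone, hW, Option.elim_none, Option.elim_some]
        have h2 : ∀ a b, w a * w b / F * ((f a - c) + (c - f b)) =
            w a * (w b * (c - f b) / F) + (w a * (f a - c)) * (w b / F) := fun a b => by ring
        simp only [h2, Finset.sum_add_distrib]
        have h3 : ∑ a ∈ A, ∑ b ∈ B, w a * (w b * (c - f b) / F) = ∑ a ∈ A, w a * (G / F) := by
          refine Finset.sum_congr rfl fun a ha => ?_
          rw [← Finset.mul_sum, ← Finset.sum_div]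
        have h4 : ∑ a ∈ A, ∑ b ∈ B, (w a * (f a - c)) * (w b / F) = ∑ b ∈ B, w b := by
          rw [Finset.sum_comm]
          refine Finset.sum_congr rfl fun b hb => ?_
          rw [← Finset.sum_mul, ← hF, mul_div_cancel₀ _ hF1.ne']
        rw [h3, h4, ← add_assoc, ← Finset.sum_add_distrib]
        congr 1
        exact Finset.sum_congr rfl fun a ha => by ring
      · rintro ⟨a, o⟩ hp
        rw [Finset.mem_product] at hp
        cases o with
        | none => exact hAC a hp.1
        | some b => exact hZC a hp.1 b (by simpa using hp.2)
  · apply convexHull_min _ ((convex_convexHull ℝ _).inter (convex_halfSpace_ge f.isLinear c))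
    intro v hv
    rw [Finset.mem_coe, Finset.mem_union] at hv
    rcases hv with hv | hv
    · have := Finset.mem_filter.1 hv
      exact ⟨subset_convexHull ℝ _ this.1, this.2⟩
    · obtain ⟨⟨a, b⟩, hab, rfl⟩ := Finset.mem_image.1 hv
      have ha := Finset.mem_filter.1 (Finset.mem_product.1 hab).1
      have hb := Finset.mem_filter.1 (Finset.mem_product.1 hab).2
      simp only at ha hb
      have h1 : 0 ≤ f a - c := sub_nonneg.2 ha.2
      have h2 : 0 < c - f b := sub_pos.2 (not_le.1 hb.2)
      have h3 : 0 < (f a - c) + (c - f b) := by linarith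
      constructor
      · have := (convex_convexHull ℝ (t : Set E)) (subset_convexHull ℝ _ ha.1)
          (subset_convexHull ℝ _ hb.1)
          (div_nonneg h2.le h3.le) (div_nonneg h1 h3.le) (by rw [← add_div, add_comm, div_self h3.ne'])
        convert this using 1
        simp only [hz, smul_add, smul_smul, div_eq_inv_mul]
      · simp only [Set.mem_ofPred_eq, hz, map_smul, map_add, smul_eq_mul]
        rw [inv_mul_eq_div, le_div_iff₀ h3]
        apply le_of_eq
        ring

theorem inter_halfspace_le {S : Set E} (h : IsPolytope S) (f : E →ₗ[ℝ] ℝ) (c : ℝ) :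
    IsPolytope (S ∩ {x | f x ≤ c}) := by
  simpa using h.inter_halfspace (-f) (-c)

theorem inter_hyperplane {S : Set E} (h : IsPolytope S) (f : E →ₗ[ℝ] ℝ) (c : ℝ) :
    IsPolytope (S ∩ {x | f x = c}) := by
  convert (h.inter_halfspace f c).inter_halfspace_le f c using 1
  rw [Set.inter_assoc]
  congr 1
  ext x
  exact ⟨fun h => ⟨h.ge, h.le⟩, fun h => le_antisymm h.2 h.1⟩

end Module

section Inner

variable {E : Type*} [NormedAddCommGroup E] [InnerProductSpace ℝ E]

theorem isCompact {S : Set E} (h : IsPolytope S) : IsCompact S := by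
  obtain ⟨t, ht, rfl⟩ := h
  exact ht.isCompact_convexHull (𝕜 := ℝ)

/-- A bounded intersection of finitely many half-spaces is a polytope. -/
theorem of_bounded [FiniteDimensional ℝ E] (t : Finset E)
    (hb : Bornology.IsBounded {x : E | ∀ v ∈ t, inner ℝ v x ≤ 1}) :
    IsPolytope {x : E | ∀ v ∈ t, inner ℝ v x ≤ 1} := by
  classical
  obtain ⟨R, hR0, hR⟩ := hb.subset_closedBall_lt 0 (0 : E)
  obtain ⟨b, hb1, -⟩ := exists_mem_interior_convexHull_affineBasis
    (Filter.univ_mem (f := 𝓝 (0 : E)))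
  obtain ⟨ε, hε, hεb⟩ := Metric.isOpen_iff.1 isOpen_interior _ hb1
  -- A simplex containing the ball of radius `ε` about `0`, dilated by `2 * R / ε`, contains the
  -- closed ball of radius `R`; the factor `2` allows for the ball being open.
  have hbox : ∃ S : Set E, IsPolytope S ∧ Metric.closedBall 0 R ⊆ S := by
    refine ⟨_, (IsPolytope.of_finite (Set.finite_range b)).image
      ((2 * R / ε) • LinearMap.id : E →ₗ[ℝ] E).toAffineMap, ?_⟩
    intro x hx
    rw [mem_closedBall_zero_iff] at hx
    refine ⟨(ε / (2 * R)) • x, interior_subset (hεb ?_), ?_⟩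
    · rw [mem_ball_zero_iff, norm_smul, Real.norm_of_nonneg (by positivity)]
      calc ε / (2 * R) * ‖x‖ ≤ ε / (2 * R) * R := by gcongr
        _ = ε / 2 := by field_simp
        _ < ε := by linarith
    · simp only [LinearMap.coe_toAffineMap, LinearMap.smul_apply, LinearMap.id_apply, smul_smul]
      rw [show 2 * R / ε * (ε / (2 * R)) = 1 by field_simp, one_smul]
  obtain ⟨S, hS, hRS⟩ := hbox
  have hcut : ∀ u : Finset E, IsPolytope (S ∩ {x : E | ∀ v ∈ u, inner ℝ v x ≤ 1}) := by
    intro u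
    induction u using Finset.induction_on with
    | empty => simpa using hS
    | insert a u ha ih =>
      convert ih.inter_halfspace_le (innerₛₗ ℝ a) 1 using 1
      ext x
      simp only [Set.mem_inter_iff, Set.mem_ofPred_eq, Finset.forall_mem_insert,
        innerₛₗ_apply_apply]
      tauto
  convert hcut t using 1
  exact (Set.inter_eq_right.2 (hR.trans hRS)).symm

/-- A polytope with the origin in its interior is a finite intersection of half-spaces. -/
theorem exists_halfspaces [FiniteDimensional ℝ E] {S : Set E} (h : IsPolytope S)
    (h0 : (0 : E) ∈ interior S) :
    ∃ t : Finset E, S = {x : E | ∀ v ∈ t, inner ℝ v x ≤ 1} := by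
  classical
  have hS := h
  obtain ⟨s, hs, hSs⟩ := h
  lift s to Finset E using hs
  obtain ⟨ε, hε, hεb⟩ := Metric.isOpen_iff.1 isOpen_interior _ h0
  -- Polarity: the polar body of `S` is cut out by the finitely many points of `s`, and is bounded
  -- because `S` contains a ball about `0`. It is thus the hull of a finite set `t`, whose points
  -- give the half-spaces sought.
  have hpol : ∀ y : E, (∀ v ∈ s, inner ℝ v y ≤ 1) → ∀ x ∈ S, inner ℝ y x ≤ 1 := by
    intro y hy x hx
    have : convexHull ℝ (s : Set E) ⊆ {x | innerₛₗ ℝ y x ≤ 1} :=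
      convexHull_min (fun v hv => by
        simpa [real_inner_comm] using hy v hv) (convex_halfSpace_le (innerₛₗ ℝ y).isLinear 1)
    simpa using this (hSs ▸ hx)
  have hbd : Bornology.IsBounded {y : E | ∀ v ∈ s, inner ℝ v y ≤ 1} := by
    refine (Metric.isBounded_closedBall (x := (0 : E)) (r := 2 / ε)).subset fun y hy => ?_
    rw [mem_closedBall_zero_iff]
    by_cases hy0 : y = 0
    · simp only [hy0, norm_zero]
      positivity
    have hn : 0 < ‖y‖ := norm_pos_iff.2 hy0
    have h1 : (ε / 2 / ‖y‖) • y ∈ S := by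
      refine interior_subset (hεb ?_)
      rw [mem_ball_zero_iff, norm_smul, Real.norm_of_nonneg (by positivity),
        div_mul_cancel₀ _ hn.ne']
      linarith
    have h2 := hpol y hy _ h1
    rw [inner_smul_right, real_inner_self_eq_norm_sq] at h2
    have h3 : ε / 2 / ‖y‖ * ‖y‖ ^ 2 = ε / 2 * ‖y‖ := by field_simp
    rw [le_div_iff₀ hε]
    nlinarith
  obtain ⟨t, ht, hst⟩ := of_bounded s hbd
  lift t to Finset E using ht
  refine ⟨t, Set.Subset.antisymm (fun x hx v hv => ?_) fun x hx => ?_⟩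
  · exact hpol v (by have : v ∈ convexHull ℝ (t : Set E) := subset_convexHull ℝ _ hv
                     rwa [← hst] at this) x hx
  · by_contra hxS
    obtain ⟨f, u, hfu, hux⟩ := geometric_hahn_banach_closed_point hS.convex
      hS.isCompact.isClosed hxS
    have hu : 0 < u := by simpa using hfu 0 (interior_subset h0)
    -- Bipolar argument: a functional separating `x` from `S`, scaled to have bound `1` on `S`, is a
    -- point of the polar body, hence of the hull of `t`, contradicting `hx`.
    set y := (InnerProductSpace.toDual ℝ E).symm (u⁻¹ • f) with hy
    have hyv : ∀ v, inner ℝ y v = u⁻¹ * f v := fun v => by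
      rw [hy, InnerProductSpace.toDual_symm_apply]; simp
    have hyp : y ∈ {y : E | ∀ v ∈ s, inner ℝ v y ≤ 1} := fun v hv => by
      rw [real_inner_comm, hyv, inv_mul_le_one₀ hu]
      exact (hfu v (hSs ▸ subset_convexHull ℝ _ hv)).le
    rw [hst] at hyp
    have : convexHull ℝ (t : Set E) ⊆ {z | innerₛₗ ℝ x z ≤ 1} :=
      convexHull_min (fun v hv => by
        simpa [real_inner_comm] using hx v hv) (convex_halfSpace_le (innerₛₗ ℝ x).isLinear 1)
    have h3 := this hyp
    simp only [Set.mem_ofPred_eq, innerₛₗ_apply_apply] at h3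
    rw [real_inner_comm, hyv, inv_mul_le_one₀ hu] at h3
    linarith

end Inner

end IsPolytope

theorem IsPolytope.exists_image_eq {E F : Type*} [AddCommGroup E] [Module ℝ E] [AddCommGroup F]
    [Module ℝ F] {S : Set E} (h : IsPolytope S) (f : F →ᵃ[ℝ] E) (hf : Function.Injective f)
    (hS : S ⊆ Set.range f) : ∃ S' : Set F, IsPolytope S' ∧ f '' S' = S := by
  obtain ⟨t, ht, rfl⟩ := h
  refine ⟨_, IsPolytope.of_finite (ht.preimage hf.injOn), ?_⟩
  rw [f.image_convexHull, Set.image_preimage_eq_of_subset ((subset_convexHull ℝ t).trans hS)]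

/-! ### Valuations that vanish on simplices -/

/-- The valuation property for a function on (possibly empty) polytopes. -/
def IsPolytopeValuation {E : Type*} [AddCommGroup E] [Module ℝ E] (W : Set E → ℝ) : Prop :=
  ∀ P Q : Set E, IsPolytope P → IsPolytope Q → IsPolytope (P ∪ Q) → IsPolytope (P ∩ Q) →
    W P + W Q = W (P ∪ Q) + W (P ∩ Q)

/-- The function vanishes on all simplices, including the empty one. -/
def VanishesOnSimplices {E : Type*} [AddCommGroup E] [Module ℝ E] (W : Set E → ℝ) : Prop :=
  ∀ (k : ℕ) (v : Fin k → E), AffineIndependent ℝ v → W (convexHull ℝ (Set.range v)) = 0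

section Module

variable {E F : Type*} [AddCommGroup E] [Module ℝ E] [AddCommGroup F] [Module ℝ F]

theorem IsPolytopeValuation.comp_image {W : Set E → ℝ} (h : IsPolytopeValuation W) (f : F →ᵃ[ℝ] E)
    (hf : Function.Injective f) : IsPolytopeValuation fun S : Set F => W (f '' S) := by
  intro P Q hP hQ hU hI
  have := h _ _ (hP.image f) (hQ.image f) (by rw [← Set.image_union]; exact hU.image f)
    (by rw [← Set.image_inter hf]; exact hI.image f)
  rwa [← Set.image_union, ← Set.image_inter hf] at this

theorem VanishesOnSimplices.comp_image {W : Set E → ℝ} (h : VanishesOnSimplices W) (f : F →ᵃ[ℝ] E)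
    (hf : Function.Injective f) : VanishesOnSimplices fun S : Set F => W (f '' S) := by
  intro k v hv
  have := h k (f ∘ v) (hv.map' f hf)
  rwa [Set.range_comp, ← f.image_convexHull] at this

theorem VanishesOnSimplices.empty {W : Set E → ℝ} (h : VanishesOnSimplices W) : W ∅ = 0 := by
  simpa using h 0 Fin.elim0 (affineIndependent_of_subsingleton ℝ _)

theorem VanishesOnSimplices.singleton {W : Set E → ℝ} (h : VanishesOnSimplices W) (x : E) :
    W {x} = 0 := by
  simpa using h 1 (fun _ => x) (affineIndependent_of_subsingleton ℝ _)

theorem mem_convexHull_insert_zero {A : Set E} (hA : Convex ℝ A) {y : E} :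
    y ∈ convexHull ℝ (insert 0 A) ↔ y = 0 ∨ ∃ r : ℝ, 0 < r ∧ r ≤ 1 ∧ ∃ a ∈ A, y = r • a := by
  rcases A.eq_empty_or_nonempty with rfl | hne
  · simp
  rw [convexHull_insert hne, hA.convexHull_eq, mem_convexJoin]
  constructor
  · rintro ⟨_, rfl, a, ha, s, r, hs, hr, hsr, rfl⟩
    rcases hr.eq_or_lt with rfl | hr0
    · left; simp
    · exact Or.inr ⟨r, hr0, by linarith, a, ha, by simp⟩
  · rintro (rfl | ⟨r, hr0, hr1, a, ha, rfl⟩)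
    · obtain ⟨a, ha⟩ := hne
      exact ⟨0, rfl, a, ha, left_mem_segment ℝ _ _⟩
    · exact ⟨0, rfl, a, ha, 1 - r, r, by linarith, hr0.le, by ring, by simp⟩

/-- Coning off from the origin turns a valuation into a valuation on an affine hyperplane. -/
theorem IsPolytopeValuation.cone {W : Set E → ℝ} (h : IsPolytopeValuation W) (f : F →ᵃ[ℝ] E)
    (hf : Function.Injective f) (g : E →ₗ[ℝ] ℝ) (hg : ∀ x, g (f x) = 1) :
    IsPolytopeValuation fun S : Set F => W (convexHull ℝ (insert 0 (f '' S))) := by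
  intro P Q hP hQ hU hI
  have hmem : ∀ {S : Set F}, IsPolytope S → ∀ y : E, y ∈ convexHull ℝ (insert 0 (f '' S)) ↔
      y = 0 ∨ ∃ r : ℝ, 0 < r ∧ r ≤ 1 ∧ ∃ a ∈ S, y = r • f a := fun {S} hS y => by
    rw [mem_convexHull_insert_zero (hS.image f).convex]
    simp
  have h1 : convexHull ℝ (insert 0 (f '' (P ∪ Q))) =
      convexHull ℝ (insert 0 (f '' P)) ∪ convexHull ℝ (insert 0 (f '' Q)) := by
    ext y
    rw [Set.mem_union, hmem hU, hmem hP, hmem hQ]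
    constructor
    · rintro (h | ⟨r, h0, h1, a, ha | ha, e⟩)
      · exact Or.inl (Or.inl h)
      · exact Or.inl (Or.inr ⟨r, h0, h1, a, ha, e⟩)
      · exact Or.inr (Or.inr ⟨r, h0, h1, a, ha, e⟩)
    · rintro ((h | ⟨r, h0, h1, a, ha, e⟩) | (h | ⟨r, h0, h1, a, ha, e⟩))
      · exact Or.inl h
      · exact Or.inr ⟨r, h0, h1, a, Or.inl ha, e⟩
      · exact Or.inl h
      · exact Or.inr ⟨r, h0, h1, a, Or.inr ha, e⟩
  have h2 : convexHull ℝ (insert 0 (f '' (P ∩ Q))) =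
      convexHull ℝ (insert 0 (f '' P)) ∩ convexHull ℝ (insert 0 (f '' Q)) := by
    ext y
    rw [Set.mem_inter_iff, hmem hI, hmem hP, hmem hQ]
    constructor
    · rintro (h | ⟨r, h0, h1, a, ⟨ha, ha'⟩, e⟩)
      · exact ⟨Or.inl h, Or.inl h⟩
      · exact ⟨Or.inr ⟨r, h0, h1, a, ha, e⟩, Or.inr ⟨r, h0, h1, a, ha', e⟩⟩
    · rintro ⟨h | ⟨r, h0, h1, a, ha, e⟩, h' | ⟨r', h0', h1', a', ha', e'⟩⟩
      · exact Or.inl h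
      · exact Or.inl h
      · exact Or.inl h'
      -- As `g = 1` on the hyperplane, `g` recovers the scale `r` of a point in the cone; this is
      -- why cones commute with intersection.
      · have hr : r = r' := by
          have := congrArg g (e.symm.trans e')
          simpa [hg] using this
        subst hr
        have haa : a = a' := hf (smul_right_injective E h0.ne' (e.symm.trans e'))
        subst haa
        exact Or.inr ⟨r, h0, h1, a, ⟨ha, ha'⟩, e⟩
  have := h _ _ ((hP.image f).hull_insert 0) ((hQ.image f).hull_insert 0)
    (by rw [← h1]; exact (hU.image f).hull_insert 0) (by rw [← h2]; exact (hI.image f).hull_insert 0)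
  rwa [← h1, ← h2] at this

/-- The apex lies off the hyperplane `g = 1`, so the cone over a simplex is a simplex of one
dimension more. The cone over `∅` is the point `0`. -/
theorem VanishesOnSimplices.cone {W : Set E → ℝ} (h : VanishesOnSimplices W) (f : F →ᵃ[ℝ] E)
    (hf : Function.Injective f) (g : E →ₗ[ℝ] ℝ) (hg : ∀ x, g (f x) = 1) :
    VanishesOnSimplices fun S : Set F => W (convexHull ℝ (insert 0 (f '' S))) := by
  intro k v hv
  have key := h (k + 1) (Fin.cons 0 (f ∘ v)) ?_
  · rw [Fin.range_cons, Set.range_comp] at key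
    change W (convexHull ℝ (insert 0 (f '' convexHull ℝ (Set.range v)))) = 0
    rwa [f.image_convexHull, Set.insert_eq, convexHull_convexHull_union_right, ← Set.insert_eq]
  · refine AffineIndependent.affineIndependent_of_notMem_span (i := 0) ?_ ?_
    · have h1 := (hv.map' f hf).comp_embedding
        ⟨fun x : {y : Fin (k + 1) // y ≠ 0} => x.1.pred x.2, fun x y hxy => by
          simpa [Subtype.ext_iff] using hxy⟩
      have h2 : (fun x : {y : Fin (k + 1) // y ≠ 0} =>
          (Fin.cons 0 (f ∘ v) : Fin (k + 1) → E) x) =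
          (f ∘ v) ∘ fun x : {y : Fin (k + 1) // y ≠ 0} => x.1.pred x.2 := by
        funext ⟨x, hx⟩
        obtain ⟨j, rfl⟩ := Fin.exists_succ_eq.2 hx
        simp
      rw [h2]
      exact h1
    · intro h0
      have hle : affineSpan ℝ (Fin.cons (α := fun _ => E) 0 (f ∘ v) '' {x | x ≠ 0}) ≤
          (AffineSubspace.mk' (1 : ℝ) ⊥).comap g.toAffineMap := by
        rw [affineSpan_le]
        rintro _ ⟨x, hx, rfl⟩
        obtain ⟨j, rfl⟩ := Fin.exists_succ_eq.2 hx
        simp [hg, AffineSubspace.mem_mk']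
      have := hle h0
      simp [AffineSubspace.mem_mk'] at this

end Module

section Inner

variable {E : Type*} [NormedAddCommGroup E] [InnerProductSpace ℝ E]

/-- A simple valuation vanishes if it vanishes on the conical cells of an arrangement of linear
hyperplanes. -/
theorem IsPolytopeValuation.eq_zero_of_cells {W : Set E → ℝ} (hW : IsPolytopeValuation W)
    (hplane : ∀ z : E, z ≠ 0 → ∀ (c : ℝ) (S : Set E), IsPolytope S → S ⊆ {x | inner ℝ z x = c} →
      W S = 0) (L : Finset E) : ∀ P : Set E, IsPolytope P →
    (∀ K : Set E, (∀ c : ℝ, 0 ≤ c → ∀ x ∈ K, c • x ∈ K) → IsPolytope (P ∩ K) →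
      (∀ z ∈ L, (∀ x ∈ P ∩ K, inner ℝ z x ≤ 0) ∨ (∀ x ∈ P ∩ K, 0 ≤ inner ℝ z x)) →
      W (P ∩ K) = 0) → W P = 0 := by
  classical
  induction L using Finset.induction_on with
  | empty =>
    intro P hP H
    simpa using H Set.univ (fun _ _ _ _ => trivial) (by simpa using hP)
  | insert z L hz ih =>
    intro P hP H
    by_cases hz0 : z = 0
    · refine ih P hP fun K hK hPK hs => H K hK hPK ?_
      rw [Finset.forall_mem_insert]
      exact ⟨Or.inl fun x _ => by simp [hz0], hs⟩
    -- Cutting along the hyperplane orthogonal to `z` costs nothing, since the common part has value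
    -- `0`. In each half, the half-space is absorbed into the cone `K`.
    · have h1 : IsPolytope (P ∩ {x | inner ℝ z x ≤ 0}) := hP.inter_halfspace_le (innerₛₗ ℝ z) 0
      have h2 : IsPolytope (P ∩ {x | 0 ≤ inner ℝ z x}) := hP.inter_halfspace (innerₛₗ ℝ z) 0
      have h3 : IsPolytope (P ∩ {x | inner ℝ z x = 0}) := hP.inter_hyperplane (innerₛₗ ℝ z) 0
      have hU : P ∩ {x | inner ℝ z x ≤ 0} ∪ P ∩ {x | 0 ≤ inner ℝ z x} = P := by
        rw [← Set.inter_union_distrib_left]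
        exact Set.inter_eq_left.2 fun x _ => le_total (inner ℝ z x) 0
      have hI : (P ∩ {x | inner ℝ z x ≤ 0}) ∩ (P ∩ {x | 0 ≤ inner ℝ z x}) =
          P ∩ {x | inner ℝ z x = 0} := by
        ext x
        exact ⟨fun h => ⟨h.1.1, le_antisymm h.1.2 h.2.2⟩,
          fun h => ⟨⟨h.1, h.2.le⟩, h.1, h.2.ge⟩⟩
      have hv := hW _ _ h1 h2 (by rwa [hU]) (by rwa [hI])
      rw [hU, hI, hplane z hz0 0 _ h3 Set.inter_subset_right, add_zero] at hv
      rw [← hv, ih _ h1, ih _ h2, add_zero]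
      · intro K hK hPK hs
        rw [Set.inter_assoc] at hPK hs ⊢
        refine H _ (fun c hc x hx => ⟨?_, hK c hc x hx.2⟩) hPK ?_
        · have : 0 ≤ inner ℝ z x := hx.1
          change 0 ≤ inner ℝ z (c • x)
          rw [inner_smul_right]
          positivity
        · rw [Finset.forall_mem_insert]
          exact ⟨Or.inr fun x hx => hx.2.1, hs⟩
      · intro K hK hPK hs
        rw [Set.inter_assoc] at hPK hs ⊢
        refine H _ (fun c hc x hx => ⟨?_, hK c hc x hx.2⟩) hPK ?_
        · have : inner ℝ z x ≤ 0 := hx.1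
          change inner ℝ z (c • x) ≤ 0
          rw [inner_smul_right]
          exact mul_nonpos_of_nonneg_of_nonpos hc this
        · rw [Finset.forall_mem_insert]
          exact ⟨Or.inl fun x hx => hx.2.1, hs⟩

theorem Finset.exists_top_of_total {α : Type*} (r : α → α → Prop) (htrans : ∀ a b c, r a b → r b c → r a c)
    (s : Finset α) (hs : s.Nonempty) (htot : ∀ a ∈ s, ∀ b ∈ s, r a b ∨ r b a) :
    ∃ a ∈ s, ∀ b ∈ s, r b a := by
  classical
  induction hs using Finset.Nonempty.cons_induction with
  | singleton a => exact ⟨a, by simp, by simpa using htot a (by simp) a (by simp)⟩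
  | cons a s ha hs ih =>
    obtain ⟨b, hb, hmax⟩ := ih fun x hx y hy => htot x (by simp [hx]) y (by simp [hy])
    rcases htot a (by simp) b (by simp [hb]) with h | h
    · refine ⟨b, by simp [hb], fun x hx => ?_⟩
      rcases Finset.mem_cons.1 hx with rfl | hx
      exacts [h, hmax x hx]
    · refine ⟨a, by simp, fun x hx => ?_⟩
      rcases Finset.mem_cons.1 hx with rfl | hx
      · simpa using htot x (by simp) x (by simp)
      · exact htrans _ _ _ (hmax x hx) h

/-- The affine parametrisation `v ↦ v + x` of an affine hyperplane by a linear one. -/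
noncomputable def kerShift (z x : E) : LinearMap.ker (innerₛₗ ℝ z) →ᵃ[ℝ] E :=
  (LinearMap.ker (innerₛₗ ℝ z)).subtype.toAffineMap + AffineMap.const ℝ _ x

theorem kerShift_apply (z x : E) (v : LinearMap.ker (innerₛₗ ℝ z)) : kerShift z x v = v + x := rfl

theorem kerShift_injective (z x : E) : Function.Injective (kerShift z x) := fun v w h => by
  simpa [kerShift_apply] using h

theorem inner_kerShift (z x : E) (v : LinearMap.ker (innerₛₗ ℝ z)) :
    inner ℝ z (kerShift z x v) = inner ℝ z x := by
  have : inner ℝ z (v : E) = 0 := v.2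
  rw [kerShift_apply, inner_add_right, this, zero_add]

theorem subset_range_kerShift {z x : E} {S : Set E} (h : S ⊆ {y | inner ℝ z y = inner ℝ z x}) :
    S ⊆ Set.range (kerShift z x) := fun y hy => by
  have : inner ℝ z y = inner ℝ z x := h hy
  refine ⟨⟨y - x, ?_⟩, by simp [kerShift_apply]⟩
  simp [LinearMap.mem_ker, inner_sub_right, this]

theorem finrank_ker_inner [FiniteDimensional ℝ E] {z : E} (hz : z ≠ 0) :
    Module.finrank ℝ (LinearMap.ker (innerₛₗ ℝ z)) + 1 = Module.finrank ℝ E := by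
  refine Module.Dual.finrank_ker_add_one_of_ne_zero (f := innerₛₗ ℝ z) fun h => hz ?_
  have := LinearMap.congr_fun h z
  simpa using this

theorem exists_subset_hyperplane [FiniteDimensional ℝ E] {S : Set E} (hS : Convex ℝ S)
    (hne : S.Nonempty) (h : ¬ (interior S).Nonempty) :
    ∃ z : E, z ≠ 0 ∧ ∃ x : E, S ⊆ {y | inner ℝ z y = inner ℝ z x} := by
  rw [hS.interior_nonempty_iff_affineSpan_eq_top,
    ← AffineSubspace.direction_eq_top_iff_of_nonempty ((affineSpan_nonempty (k := ℝ)).2 hne),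
    ← Submodule.orthogonal_eq_bot_iff] at h
  obtain ⟨z, hz, hz0⟩ := Submodule.exists_mem_ne_zero_of_ne_bot h
  obtain ⟨x, hx⟩ := hne
  refine ⟨z, hz0, x, fun y hy => ?_⟩
  have := (Submodule.mem_orthogonal' _ _).1 hz (y - x)
    (AffineSubspace.vsub_mem_direction (subset_affineSpan ℝ S hy) (subset_affineSpan ℝ S hx))
  rw [inner_sub_right, sub_eq_zero] at this
  exact this

end Inner

/-- A valuation on polytopes that vanishes on all simplices is zero. -/
theorem IsPolytopeValuation.eq_zero {E : Type*} [NormedAddCommGroup E] [InnerProductSpace ℝ E]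
    [FiniteDimensional ℝ E] {W : Set E → ℝ} (hW : IsPolytopeValuation W)
    (hs : VanishesOnSimplices W) {P : Set E} (hP : IsPolytope P) : W P = 0 := by
  classical
  obtain ⟨d, hd⟩ : ∃ d, Module.finrank ℝ E = d := ⟨_, rfl⟩
  induction d generalizing E with
  | zero =>
    have := Module.finrank_zero_iff.1 hd
    rcases P.eq_empty_or_nonempty with rfl | ⟨x, hx⟩
    · exact hs.empty
    · rw [show P = {x} from Set.eq_singleton_iff_unique_mem.2 ⟨hx, fun y _ => Subsingleton.elim _ _⟩]
      exact hs.singleton x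
  | succ d ih =>
    have hdk : ∀ {z : E}, z ≠ 0 → Module.finrank ℝ (LinearMap.ker (innerₛₗ ℝ z)) = d := fun hz => by
      have := finrank_ker_inner hz
      omega
    -- The induction hypothesis makes `W` simple. `W` is quantified here and in `hint` because
    -- moving an interior point to the origin replaces it by a translate.
    have hplane : ∀ {W : Set E → ℝ}, IsPolytopeValuation W → VanishesOnSimplices W →
        ∀ z : E, z ≠ 0 → ∀ (c : ℝ) (S : Set E), IsPolytope S → S ⊆ {x | inner ℝ z x = c} →
        W S = 0 := by
      intro W hW hs z hz c S hS hSc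
      rcases S.eq_empty_or_nonempty with rfl | ⟨x, hx⟩
      · exact hs.empty
      obtain rfl : inner ℝ z x = c := hSc hx
      obtain ⟨S', hS', rfl⟩ := hS.exists_image_eq (kerShift z x) (kerShift_injective z x)
        (subset_range_kerShift hSc)
      exact ih (hW.comp_image _ (kerShift_injective z x)) (hs.comp_image _ (kerShift_injective z x))
        hS' (hdk hz)
    have hint : ∀ {W : Set E → ℝ}, IsPolytopeValuation W → VanishesOnSimplices W →
        ∀ {P : Set E}, IsPolytope P → 0 ∈ interior P → W P = 0 := by
      intro W hW hs P hP h0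
      obtain ⟨t, ht⟩ := hP.exists_halfspaces h0
      -- Otherwise the whole ray through `x` would satisfy the inequalities, against boundedness.
      have hnt : ∀ x : E, x ≠ 0 → ∃ v ∈ t, 0 < inner ℝ v x := by
        intro x hx
        by_contra! hcon
        obtain ⟨R, hR⟩ := hP.isCompact.isBounded.subset_closedBall (0 : E)
        have hn : 0 < ‖x‖ := norm_pos_iff.2 hx
        have h1 : ((|R| + 1) / ‖x‖) • x ∈ P := by
          rw [ht]
          intro v hv
          rw [inner_smul_right]
          have : (|R| + 1) / ‖x‖ * inner ℝ v x ≤ 0 :=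
            mul_nonpos_of_nonneg_of_nonpos (by positivity) (hcon v hv)
          linarith
        have h2 := hR h1
        rw [mem_closedBall_zero_iff, norm_smul, Real.norm_of_nonneg (by positivity),
          div_mul_cancel₀ _ hn.ne'] at h2
        linarith [le_abs_self R]
      -- With a constant sign for every difference `v - w`, the functionals of `t` are totally
      -- ordered on each cell. One of them, `y`, is largest there, so on the cell only the
      -- inequality of `y` matters.
      refine hW.eq_zero_of_cells (hplane hW hs) ((t ×ˢ t).image fun p => p.1 - p.2) P hP ?_
      intro K hK hPK hsign
      by_cases htriv : P ∩ K ⊆ {0}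
      · rcases Set.subset_singleton_iff_eq.1 htriv with h | h
        · rw [h, hs.empty]
        · rw [h, hs.singleton]
      obtain ⟨x₀, hx₀, hx₀0⟩ := Set.not_subset.1 htriv
      replace hx₀0 : x₀ ≠ 0 := hx₀0
      obtain ⟨y, hyt, hy⟩ := Finset.exists_top_of_total
        (fun a b : E => ∀ x ∈ P ∩ K, inner ℝ a x ≤ inner ℝ b x)
        (fun a b c h1 h2 x hx => (h1 x hx).trans (h2 x hx)) t
        (by obtain ⟨v, hv, -⟩ := hnt x₀ hx₀0; exact ⟨v, hv⟩) (by
          intro a ha b hb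
          have := hsign (a - b) (Finset.mem_image.2 ⟨(a, b), Finset.mem_product.2 ⟨ha, hb⟩, rfl⟩)
          refine this.imp (fun h x hx => ?_) fun h x hx => ?_
          · have := h x hx
            rw [inner_sub_left] at this
            linarith
          · have := h x hx
            rw [inner_sub_left] at this
            linarith)
      have hpos : ∀ x ∈ P ∩ K, x ≠ 0 → 0 < inner ℝ y x := fun x hx hx0 => by
        obtain ⟨v, hv, hvx⟩ := hnt x hx0
        exact hvx.trans_le (hy v hv x hx)
      have hy0 : y ≠ 0 := by
        rintro rfl
        simpa using hpos x₀ hx₀ hx₀0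
      -- The foot of the perpendicular from `0` to the hyperplane `inner ℝ y x = 1`.
      set x₁ : E := (‖y‖ ^ 2)⁻¹ • y with hx₁
      have hyx₁ : inner ℝ y x₁ = 1 := by
        rw [hx₁, inner_smul_right, real_inner_self_eq_norm_sq, inv_mul_cancel₀]
        have := norm_pos_iff.2 hy0
        positivity
      have hQ : IsPolytope (P ∩ K ∩ {x | inner ℝ y x = 1}) := hPK.inter_hyperplane (innerₛₗ ℝ y) 1
      obtain ⟨Q, hQp, hQe⟩ := hQ.exists_image_eq (kerShift y x₁) (kerShift_injective y x₁)
        (subset_range_kerShift fun x hx => by rw [Set.mem_ofPred_eq, hyx₁]; exact hx.2)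
      have hker : ∀ v, innerₛₗ ℝ y (kerShift y x₁ v) = 1 := fun v => by
        rw [innerₛₗ_apply_apply, inner_kerShift, hyx₁]
      -- The cell is the cone from `0` over its part `Q` in the hyperplane `inner ℝ y x = 1`, so the
      -- induction hypothesis applies to the coned-off valuation.
      have key := ih (hW.cone (kerShift y x₁) (kerShift_injective y x₁) (innerₛₗ ℝ y) hker)
        (hs.cone (kerShift y x₁) (kerShift_injective y x₁) (innerₛₗ ℝ y) hker) hQp (hdk hy0)
      convert key using 2
      rw [hQe]
      ext x
      rw [mem_convexHull_insert_zero hQ.convex]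
      constructor
      · intro hx
        by_cases hx0 : x = 0
        · exact Or.inl hx0
        have hp := hpos x hx hx0
        refine Or.inr ⟨inner ℝ y x, hp, ?_, (inner ℝ y x)⁻¹ • x, ⟨⟨?_, hK _ (by positivity) _ hx.2⟩, ?_⟩, ?_⟩
        · have := hx.1
          rw [ht] at this
          exact this y hyt
        · rw [ht]
          intro v hv
          rw [inner_smul_right, inv_mul_le_one₀ hp]
          exact hy v hv x hx
        · rw [Set.mem_ofPred_eq, inner_smul_right, inv_mul_cancel₀ hp.ne']
        · rw [smul_smul, mul_inv_cancel₀ hp.ne', one_smul]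
      · rintro (rfl | ⟨r, hr0, hr1, a, ha, rfl⟩)
        · exact ⟨interior_subset h0, by simpa using hK 0 le_rfl _ hx₀.2⟩
        · refine ⟨?_, hK r hr0.le a ha.1.2⟩
          have := hP.convex (interior_subset h0) ha.1.1 (sub_nonneg.2 hr1) hr0.le (by ring)
          simpa using this
    by_cases hi : (interior P).Nonempty
    · obtain ⟨p, hp⟩ := hi
      set f : E ≃ᵃ[ℝ] E := AffineEquiv.constVAdd ℝ E p with hf
      have hfi : Function.Injective f.toAffineMap := f.injective
      obtain ⟨P', hP', rfl⟩ := hP.exists_image_eq f.toAffineMap hfi fun x _ => f.surjective x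
      refine hint (hW.comp_image f.toAffineMap hfi) (hs.comp_image f.toAffineMap hfi) hP' ?_
      have : interior (f.toAffineMap '' P') = f.toAffineMap '' interior P' :=
        ((Homeomorph.addLeft p).image_interior P').symm
      rw [this] at hp
      obtain ⟨q, hq, hqp⟩ := hp
      have : q = 0 := by simpa [hf] using hqp
      rwa [← this]
    · rcases P.eq_empty_or_nonempty with rfl | hne
      · exact hs.empty
      obtain ⟨z, hz, x, hx⟩ := exists_subset_hyperplane hP.convex hne hi
      exact hplane hW hs z hz _ P hP hx

/-! ### Equi-affine invariant valuations on simplices -/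

/-- Invariance under volume-preserving affine maps. -/
def IsEquiAffineInvariant {E : Type*} [AddCommGroup E] [Module ℝ E] (W : Set E → ℝ) : Prop :=
  ∀ φ : E →ₗ[ℝ] E, LinearMap.det φ = 1 → ∀ (x : E) (S : Set E), IsPolytope S →
    W ((φ.toAffineMap + AffineMap.const ℝ E x) '' S) = W S

section Simplex

variable {E ι : Type*} [AddCommGroup E] [Module ℝ E]

/-- The simplex spanned by `x e_i`, `y e_i` and the `e_j` with `j ∈ J`. -/
def axisSimplex (e : ι → E) (i : ι) (J : Finset ι) (x y : ℝ) : Set E :=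
  convexHull ℝ (insert (x • e i) (insert (y • e i) (e '' (J : Set ι))))

/-- The simplex spanned by the origin and the `e_j` with `j ∈ J`. -/
def cornerSimplex (e : ι → E) (J : Finset ι) : Set E :=
  convexHull ℝ (insert 0 (e '' (J : Set ι)))

theorem isPolytope_axisSimplex (e : ι → E) (i : ι) (J : Finset ι) (x y : ℝ) :
    IsPolytope (axisSimplex e i J x y) :=
  IsPolytope.of_finite (((J.finite_toSet.image e).insert _).insert _)

theorem isPolytope_cornerSimplex (e : ι → E) (J : Finset ι) : IsPolytope (cornerSimplex e J) :=
  IsPolytope.of_finite ((J.finite_toSet.image e).insert _)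

theorem axisSimplex_comm (e : ι → E) (i : ι) (J : Finset ι) (x y : ℝ) :
    axisSimplex e i J x y = axisSimplex e i J y x := by
  rw [axisSimplex, Set.insert_comm, axisSimplex]

theorem axisSimplex_zero_zero (e : ι → E) (i : ι) (J : Finset ι) :
    axisSimplex e i J 0 0 = cornerSimplex e J := by
  rw [axisSimplex, zero_smul, Set.insert_idem, cornerSimplex]

theorem axisSimplex_zero_one [DecidableEq ι] (e : ι → E) (i : ι) (J : Finset ι) :
    axisSimplex e i J 0 1 = cornerSimplex e (insert i J) := by
  rw [axisSimplex, zero_smul, one_smul, cornerSimplex, Finset.coe_insert, Set.image_insert_eq]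

/-- Since `v` is off the level `m` of `h` while `A` is on it, a point at level `m` can give `v` no
weight. -/
theorem mem_convexHull_of_mem_convexHull_insert (h : E →ₗ[ℝ] ℝ) {m : ℝ} {A : Set E}
    (hA : A.Nonempty) (hm : ∀ a ∈ A, h a = m) {v x : E} (hv : h v ≠ m)
    (hx : x ∈ convexHull ℝ (insert v A)) (hxm : h x = m) : x ∈ convexHull ℝ A := by
  rw [convexHull_insert hA, mem_convexJoin] at hx
  obtain ⟨_, hv', a, ha, s, r, hs, hr, hsr, rfl⟩ := hx
  rw [Set.mem_singleton_iff.1 hv'] at hxm ⊢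
  have ham : h a = m := by
    have : convexHull ℝ A ⊆ {x | h x = m} := convexHull_min hm (convex_hyperplane h.isLinear m)
    exact this ha
  rw [map_add, map_smul, map_smul, ham, smul_eq_mul, smul_eq_mul] at hxm
  have h1 : s * (h v - m) = 0 := by
    rw [mul_sub]
    have : r = 1 - s := by linarith
    subst this
    linarith
  have hs0 : s = 0 := (mul_eq_zero.1 h1).resolve_right (sub_ne_zero.2 hv)
  subst hs0
  rw [zero_add] at hsr
  subst hsr
  simpa using ha

theorem smul_mem_segment_smul {e : E} {a b t : ℝ} (h1 : a ≤ t) (h2 : t ≤ b) :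
    t • e ∈ segment ℝ (a • e) (b • e) := by
  have h : t ∈ segment ℝ a b := by
    rw [segment_eq_Icc (h1.trans h2)]
    exact ⟨h1, h2⟩
  have := Set.mem_image_of_mem (LinearMap.toSpanSingleton ℝ E e).toAffineMap h
  rw [image_segment] at this
  simpa using this

theorem axisSimplex_subset (e : ι → E) (i : ι) (J : Finset ι) {x y x' y' : ℝ} (hx : x ∈ Set.Icc x' y')
    (hy : y ∈ Set.Icc x' y') : axisSimplex e i J x y ⊆ axisSimplex e i J x' y' := by
  have hseg : ∀ t ∈ Set.Icc x' y', t • e i ∈ axisSimplex e i J x' y' := fun t ht =>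
    (convex_convexHull ℝ _).segment_subset (subset_convexHull ℝ _ (by simp))
      (subset_convexHull ℝ _ (by simp)) (smul_mem_segment_smul ht.1 ht.2)
  refine convexHull_min ?_ (convex_convexHull ℝ _)
  rintro p (rfl | rfl | hp)
  · exact hseg x hx
  · exact hseg y hy
  · exact subset_convexHull ℝ _ (Or.inr (Or.inr hp))

theorem axisSimplex_union (e : ι → E) (i : ι) (J : Finset ι) {a m c : ℝ} (ham : a ≤ m)
    (hmc : m ≤ c) : axisSimplex e i J a m ∪ axisSimplex e i J m c = axisSimplex e i J a c := by
  apply Set.Subset.antisymm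
  · exact Set.union_subset (axisSimplex_subset e i J ⟨le_rfl, ham.trans hmc⟩ ⟨ham, hmc⟩)
      (axisSimplex_subset e i J ⟨ham, hmc⟩ ⟨ham.trans hmc, le_rfl⟩)
  · have hA : (insert (m • e i) (e '' (J : Set ι))).Nonempty := Set.insert_nonempty _ _
    have h1 : axisSimplex e i J a c ⊆
        convexHull ℝ ({a • e i, c • e i} ∪ insert (m • e i) (e '' (J : Set ι))) :=
      convexHull_mono (by
        rintro p (rfl | rfl | hp)
        · simp
        · simp
        · exact Or.inr (Or.inr hp))
    intro x hx
    have hx := h1 hx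
    rw [convexHull_union (Set.insert_nonempty _ _) hA, convexHull_pair, mem_convexJoin] at hx
    obtain ⟨z, hz, p, hp, hx⟩ := hx
    have hz' : ∃ t, a ≤ t ∧ t ≤ c ∧ t • e i = z := by
      have h2 := image_segment ℝ (LinearMap.toSpanSingleton ℝ E (e i)).toAffineMap a c
      simp only [LinearMap.coe_toAffineMap, LinearMap.toSpanSingleton_apply] at h2
      rw [← h2, segment_eq_Icc (ham.trans hmc)] at hz
      obtain ⟨t, ht, rfl⟩ := hz
      exact ⟨t, ht.1, ht.2, by simp⟩
    obtain ⟨t, hat, htc, rfl⟩ := hz'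
    rcases le_total t m with htm | htm
    · left
      refine (convex_convexHull ℝ _).segment_subset ?_
        (convexHull_mono (Set.subset_insert _ _) hp) hx
      exact axisSimplex_subset e i J (x := t) (y := t) ⟨hat, htm⟩ ⟨hat, htm⟩
        (subset_convexHull ℝ _ (by simp))
    · right
      refine (convex_convexHull ℝ _).segment_subset ?_
        (convexHull_mono (Set.insert_subset_insert (Set.subset_insert _ _)) hp) hx
      exact axisSimplex_subset e i J (x := t) (y := t) ⟨htm, htc⟩ ⟨htm, htc⟩
        (subset_convexHull ℝ _ (by simp))

/-- Scaling of a single basis vector. -/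
noncomputable def axisScale (e : Module.Basis ι ℝ E) (i : ι) (c : ℝ) : E →ₗ[ℝ] E :=
  LinearMap.transvection ((c - 1) • e.coord i) (e i)

theorem det_axisScale [Finite ι] (e : Module.Basis ι ℝ E) (i : ι) (c : ℝ) :
    LinearMap.det (axisScale e i c) = c := by
  have := e.finiteDimensional_of_finite
  rw [axisScale, LinearMap.transvection.det]
  simp

theorem axisScale_self (e : Module.Basis ι ℝ E) (i : ι) (c : ℝ) : axisScale e i c (e i) = c • e i := by
  rw [axisScale, LinearMap.transvection.apply]
  simp [sub_smul]

theorem axisScale_of_ne (e : Module.Basis ι ℝ E) {i j : ι} (h : j ≠ i) (c : ℝ) :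
    axisScale e i c (e j) = e j := by
  rw [axisScale, LinearMap.transvection.apply]
  simp [h]

theorem axisScale_image_cornerSimplex (e : Module.Basis ι ℝ E) {i : ι} {J : Finset ι} (hi : i ∉ J)
    (c : ℝ) : axisScale e i c '' cornerSimplex e J = cornerSimplex e J := by
  rw [cornerSimplex, LinearMap.image_convexHull, Set.image_insert_eq, map_zero, Set.image_image]
  congr 2
  exact Set.image_congr fun j hj => axisScale_of_ne e (ne_of_mem_of_not_mem (Finset.mem_coe.1 hj) hi) c

theorem axisScale_image_axisSimplex (e : Module.Basis ι ℝ E) {i : ι} {J : Finset ι} (hi : i ∉ J)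
    (c x y : ℝ) :
    axisScale e i c '' axisSimplex e i J x y = axisSimplex e i J (x * c) (y * c) := by
  rw [axisSimplex, LinearMap.image_convexHull, Set.image_insert_eq, Set.image_insert_eq,
    Set.image_image, map_smul, map_smul, axisScale_self, smul_smul, smul_smul, axisSimplex]
  congr 3
  exact Set.image_congr fun j hj => axisScale_of_ne e (ne_of_mem_of_not_mem (Finset.mem_coe.1 hj) hi) c

theorem affine_image_comp (A B : E →ₗ[ℝ] E) (x : E) (S : Set E) :
    ((A ∘ₗ B).toAffineMap + AffineMap.const ℝ E x) '' S =
      (A.toAffineMap + AffineMap.const ℝ E x) '' (B '' S) := by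
  rw [Set.image_image]
  rfl

/-- Every simplex is an affine image of a face of the corner simplex. -/
theorem exists_cornerSimplex_image [Fintype ι] (e : Module.Basis ι ℝ E) {k : ℕ} (v : Fin (k + 1) → E)
    (hv : AffineIndependent ℝ v) :
    ∃ (J : Finset ι) (A : E →ₗ[ℝ] E) (x : E), LinearMap.det A ≠ 0 ∧
      convexHull ℝ (Set.range v) =
        (A.toAffineMap + AffineMap.const ℝ E x) '' cornerSimplex e J := by
  classical
  have := e.finiteDimensional_of_finite
  rw [affineIndependent_iff_linearIndependent_vsub ℝ v 0] at hv
  set s : Set E := Set.range fun i : {x : Fin (k + 1) // x ≠ 0} => v i -ᵥ v 0 with hs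
  have hsl : LinearIndepOn ℝ id s := hv.linearIndepOn_id
  set b := Module.Basis.extend hsl with hb
  set σ : ι ≃ hsl.extend (Set.subset_univ s) := e.indexEquiv b
  refine ⟨Finset.univ.filter fun j => (σ j : E) ∈ s, (e.equiv b σ : E →ₗ[ℝ] E), v 0,
    -- `A` carries the basis `e` to a basis extending the edge vectors at `v 0`, and `J` indexes
    -- those `e j` that land on edge vectors.
    (LinearEquiv.isUnit_det' _).ne_zero, ?_⟩
  rw [cornerSimplex, AffineMap.image_convexHull]
  congr 1
  rw [Set.image_insert_eq, Set.image_image]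
  have hA : ∀ j, e.equiv b σ (e j) = (σ j : E) := fun j => by
    rw [Module.Basis.equiv_apply, hb, Module.Basis.extend_apply_self]
  ext p
  simp only [Set.mem_range, AffineMap.coe_add, Pi.add_apply, LinearMap.coe_toAffineMap,
    AffineMap.const_apply, map_zero, zero_add, LinearEquiv.coe_coe, hA, Set.mem_insert_iff,
    Set.mem_image, Finset.coe_filter, Finset.mem_univ, true_and, Set.mem_ofPred_eq]
  constructor
  · rintro ⟨j, rfl⟩
    by_cases hj : j = 0
    · exact Or.inl (by rw [hj])
    · right
      have hjs : v j - v 0 ∈ s := ⟨⟨j, hj⟩, rfl⟩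
      refine ⟨σ.symm ⟨v j - v 0, hsl.subset_extend _ hjs⟩, ?_, ?_⟩
      · simpa using hjs
      · simp
  · rintro (rfl | ⟨j, hj, rfl⟩)
    · exact ⟨0, rfl⟩
    · obtain ⟨l, hl⟩ := hj
      refine ⟨l, ?_⟩
      simp only at hl
      rw [← hl, vsub_eq_sub, sub_add_cancel]

/-- Scaling the spare direction `e i` fixes the simplex, so it can bring the determinant of `A` to
`1`. -/
theorem IsEquiAffineInvariant.image_cornerSimplex [Finite ι] {W : Set E → ℝ} (hW : IsEquiAffineInvariant W)
    (e : Module.Basis ι ℝ E) {i : ι} {J : Finset ι} (hi : i ∉ J) (A : E →ₗ[ℝ] E)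
    (hA : LinearMap.det A ≠ 0) (x : E) :
    W ((A.toAffineMap + AffineMap.const ℝ E x) '' cornerSimplex e J) = W (cornerSimplex e J) := by
  rw [← hW (A ∘ₗ axisScale e i (LinearMap.det A)⁻¹)
    (by rw [LinearMap.det_comp, det_axisScale, mul_inv_cancel₀ hA]) x (cornerSimplex e J)
    (isPolytope_cornerSimplex _ _),
    affine_image_comp, axisScale_image_cornerSimplex e hi]

/-- After composition with the inverse scaling of `e i`, `A` has determinant `1`; so only the signed
factor `det A` along that axis is left. -/
theorem IsEquiAffineInvariant.image_axisSimplex [Finite ι] {W : Set E → ℝ} (hW : IsEquiAffineInvariant W)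
    (e : Module.Basis ι ℝ E) {i : ι} {J : Finset ι} (hi : i ∉ J) (A : E →ₗ[ℝ] E)
    (hA : LinearMap.det A ≠ 0) (x : E) :
    W ((A.toAffineMap + AffineMap.const ℝ E x) '' axisSimplex e i J 0 1) =
      W (axisSimplex e i J 0 (LinearMap.det A)) := by
  rw [← hW (A ∘ₗ axisScale e i (LinearMap.det A)⁻¹)
    (by rw [LinearMap.det_comp, det_axisScale, mul_inv_cancel₀ hA]) x
    (axisSimplex e i J 0 (LinearMap.det A)) (isPolytope_axisSimplex _ _ _ _ _), affine_image_comp, axisScale_image_axisSimplex e hi,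
    zero_mul, mul_inv_cancel₀ hA]

variable [DecidableEq ι]

theorem axisSimplex_inter (e : Module.Basis ι ℝ E) {i : ι} {J : Finset ι} (hi : i ∉ J) {a m c : ℝ}
    (ham : a < m) (hmc : m < c) :
    axisSimplex e i J a m ∩ axisSimplex e i J m c = axisSimplex e i J m m := by
  apply Set.Subset.antisymm
  · rintro x ⟨h1, h2⟩
    -- The level set `h = m` contains the common face, and `a • e i` and `c • e i` lie strictly on
    -- opposite sides of it.
    set h : E →ₗ[ℝ] ℝ := e.constr ℝ fun j => if j = i then 1 else m with hh
    have hei : h (e i) = 1 := by simp [hh, Module.Basis.constr_basis]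
    have hA : ∀ p ∈ insert (m • e i) (e '' (J : Set ι)), h p = m := by
      rintro p (rfl | ⟨j, hj, rfl⟩)
      · rw [map_smul, hei, smul_eq_mul, mul_one]
      · have : j ≠ i := fun hji => hi (hji ▸ hj)
        simp [hh, Module.Basis.constr_basis, this]
    have hle : h x ≤ m := by
      have : axisSimplex e i J a m ⊆ {x | h x ≤ m} := by
        refine convexHull_min ?_ (convex_halfSpace_le h.isLinear m)
        rintro p (rfl | hp)
        · simp [hei, ham.le]
        · exact (hA p hp).le
      exact this h1
    have hge : m ≤ h x := by
      have : axisSimplex e i J m c ⊆ {x | m ≤ h x} := by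
        rw [axisSimplex_comm]
        refine convexHull_min ?_ (convex_halfSpace_ge h.isLinear m)
        rintro p (rfl | hp)
        · simp [hei, hmc.le]
        · exact (hA p hp).ge
      exact this h2
    have := mem_convexHull_of_mem_convexHull_insert h (Set.insert_nonempty _ _) hA
      (v := a • e i) (by simp [hei, ham.ne]) h1 (le_antisymm hle hge)
    rwa [axisSimplex, Set.insert_idem]
  · exact Set.subset_inter (axisSimplex_subset e i J ⟨ham.le, le_rfl⟩ ⟨ham.le, le_rfl⟩)
      (axisSimplex_subset e i J ⟨le_rfl, hmc.le⟩ ⟨le_rfl, hmc.le⟩)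

theorem IsPolytopeValuation.axisSimplex_split {W : Set E → ℝ} (hW : IsPolytopeValuation W)
    (e : Module.Basis ι ℝ E) {i : ι} {J : Finset ι} (hi : i ∉ J) {a m c : ℝ}
    (ham : a < m) (hmc : m < c) :
    W (axisSimplex e i J a m) + W (axisSimplex e i J m c) =
      W (axisSimplex e i J a c) + W (axisSimplex e i J m m) := by
  have hU := axisSimplex_union e i J ham.le hmc.le
  have hI := axisSimplex_inter e hi ham hmc
  rw [hW _ _ (isPolytope_axisSimplex _ _ _ _ _) (isPolytope_axisSimplex _ _ _ _ _)
    (by rw [hU]; exact isPolytope_axisSimplex _ _ _ _ _)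
    (by rw [hI]; exact isPolytope_axisSimplex _ _ _ _ _), hU, hI]

variable [Fintype ι]

theorem IsEquiAffineInvariant.axisSimplex_shift {W : Set E → ℝ} (hW : IsEquiAffineInvariant W)
    (e : Module.Basis ι ℝ E) {i : ι} {J : Finset ι} (hi : i ∉ J) (x y : ℝ) :
    W (axisSimplex e i J x y) = W (axisSimplex e i J 0 (y - x)) := by
  -- The shear sends `e j` to `e j - x • e i` and fixes `e i`; translation by `x • e i` then
  -- restores every `e j` and shifts the edge by `x`.
  set f : Module.Dual ℝ E := e.constr ℝ fun j => if j = i then 0 else -x with hf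
  have hfi : f (e i) = 0 := by rw [hf, Module.Basis.constr_basis, if_pos rfl]
  have hfj : ∀ j, j ≠ i → f (e j) = -x := fun j hj => by
    rw [hf, Module.Basis.constr_basis, if_neg hj]
  have := e.finiteDimensional_of_finite
  have hdet : LinearMap.det (LinearMap.transvection f (e i)) = 1 := by
    rw [LinearMap.transvection.det, hfi, add_zero]
  rw [← hW _ hdet (x • e i) (axisSimplex e i J 0 (y - x)) (isPolytope_axisSimplex _ _ _ _ _)]
  congr 1
  rw [axisSimplex, axisSimplex, AffineMap.image_convexHull]
  congr 1
  rw [Set.image_insert_eq, Set.image_insert_eq, Set.image_image]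
  congr 1
  · simp
  congr 1
  · simp only [AffineMap.coe_add, Pi.add_apply, LinearMap.coe_toAffineMap, map_smul,
      LinearMap.transvection.apply, hfi, AffineMap.const_apply]
    module
  · refine Set.image_congr fun j hj => ?_
    simp only [AffineMap.coe_add, Pi.add_apply, LinearMap.coe_toAffineMap,
      LinearMap.transvection.apply, hfj j fun h => hi (h ▸ hj), AffineMap.const_apply]
    module

/-- Cut the edge from `0` to `2 • e i` at its midpoint. Both halves and the whole share one value
`w`, the whole because the spare direction `k` absorbs the factor `2`. The common face vanishes by
induction, so `2 w = w`. -/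
theorem IsPolytopeValuation.cornerSimplex_eq_zero {W : Set E → ℝ} (hV : IsPolytopeValuation W)
    (hW : IsEquiAffineInvariant W) (h0 : W {0} = 0) (e : Module.Basis ι ℝ E) (J : Finset ι)
    (hJ : J ≠ Finset.univ) : W (cornerSimplex e J) = 0 := by
  induction J using Finset.induction_on with
  | empty => simpa [cornerSimplex] using h0
  | insert i J hi ih =>
    have ih := ih fun h => hi (h ▸ Finset.mem_univ i)
    obtain ⟨k, hk⟩ : ∃ k, k ∉ insert i J := by
      by_contra! h
      exact hJ (Finset.eq_univ_iff_forall.2 h)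
    have h1 := hV.axisSimplex_split e hi (a := 0) (m := 1) (c := 2) (by norm_num) (by norm_num)
    have h2 := hW.image_cornerSimplex e hk (axisScale e i 2) (by rw [det_axisScale]; norm_num) 0
    rw [← axisSimplex_zero_one] at h2 ⊢
    have h3 : (((axisScale e i 2).toAffineMap + AffineMap.const ℝ E 0 : E →ᵃ[ℝ] E) : E → E) =
        axisScale e i 2 := by
      ext p
      simp
    rw [h3, axisScale_image_axisSimplex e hi] at h2
    rw [hW.axisSimplex_shift e hi 1 2, hW.axisSimplex_shift e hi 1 1, sub_self,
      axisSimplex_zero_zero, ih] at h1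
    norm_num at h1 h2
    linarith

/-- The value on a simplex of signed volume `a`, relative to the corner simplex, is additive. -/
theorem IsPolytopeValuation.axisSimplex_add {W : Set E → ℝ} (hV : IsPolytopeValuation W)
    (hW : IsEquiAffineInvariant W) (h0 : W {0} = 0) (e : Module.Basis ι ℝ E) (i : ι) {a b : ℝ}
    (ha : 0 ≤ a) (hb : 0 ≤ b) :
    W (axisSimplex e i (Finset.univ.erase i) 0 (a + b)) =
      W (axisSimplex e i (Finset.univ.erase i) 0 a) +
        W (axisSimplex e i (Finset.univ.erase i) 0 b) := by
  have hi : i ∉ Finset.univ.erase i := Finset.notMem_erase _ _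
  have hz : W (axisSimplex e i (Finset.univ.erase i) 0 0) = 0 := by
    rw [axisSimplex_zero_zero]
    exact hV.cornerSimplex_eq_zero hW h0 e _ (Finset.erase_ssubset (Finset.mem_univ i)).ne
  rcases ha.eq_or_lt with rfl | ha
  · rw [hz, zero_add, zero_add]
  rcases hb.eq_or_lt with rfl | hb
  · rw [hz, add_zero, add_zero]
  have h1 := hV.axisSimplex_split e hi (a := 0) (m := a) (c := a + b) ha (by linarith)
  rw [hW.axisSimplex_shift e hi a (a + b), hW.axisSimplex_shift e hi a a, sub_self, hz,
    add_sub_cancel_left] at h1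
  linarith

/-- Orientation is irrelevant: exchanging the ends of the edge and shifting it back to `0` reverses
the sign. This reduces a negative determinant to a volume. -/
theorem IsEquiAffineInvariant.axisSimplex_abs {W : Set E → ℝ} (hW : IsEquiAffineInvariant W)
    (e : Module.Basis ι ℝ E) (i : ι) (a : ℝ) :
    W (axisSimplex e i (Finset.univ.erase i) 0 |a|) =
      W (axisSimplex e i (Finset.univ.erase i) 0 a) := by
  rcases abs_choice a with h | h
  · rw [h]
  · rw [h, axisSimplex_comm e i _ 0 a, hW.axisSimplex_shift e (Finset.notMem_erase _ _) a 0,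
      zero_sub]

end Simplex

/-! ### From simplices to all polytopes: the Cauchy function of the volume -/

section Volume

variable {E ι : Type*} [NormedAddCommGroup E] [InnerProductSpace ℝ E] [FiniteDimensional ℝ E]
  [MeasurableSpace E] (μ : Measure E) [μ.IsAddHaarMeasure]

theorem measure_cornerSimplex_univ_pos [Fintype ι] (e : Module.Basis ι ℝ E) :
    0 < μ (cornerSimplex e Finset.univ) := by
  have : (interior (cornerSimplex e Finset.univ)).Nonempty := by
    rw [cornerSimplex, interior_convexHull_nonempty_iff_affineSpan_eq_top, Finset.coe_univ,
      Set.image_univ, ← AffineSubspace.coe_eq_univ_iff, affineSpan_insert_zero, e.span_eq]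
    rfl
  exact Measure.measure_pos_of_nonempty_interior μ this

variable [BorelSpace E]

theorem measure_affine_image (A : E →ₗ[ℝ] E) (x : E) (S : Set E) :
    μ ((A.toAffineMap + AffineMap.const ℝ E x) '' S) =
      ENNReal.ofReal |LinearMap.det A| * μ S := by
  have : (A.toAffineMap + AffineMap.const ℝ E x) '' S = (fun p => p + x) '' (A '' S) := by
    rw [Set.image_image]
    rfl
  rw [this, Set.image_add_right, measure_preimage_add_right, Measure.addHaar_image_linearMap]

theorem measure_cornerSimplex_eq_zero (e : Module.Basis ι ℝ E) {J : Finset ι} {k : ι}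
    (hk : k ∉ J) : μ (cornerSimplex e J) = 0 := by
  refine measure_mono_null ?_ (Measure.addHaar_submodule μ (LinearMap.ker (e.coord k)) fun h => ?_)
  · refine convexHull_min ?_ (LinearMap.ker (e.coord k)).convex
    rintro p (rfl | ⟨j, hj, rfl⟩)
    · simp
    · have : j ≠ k := fun h => hk (h ▸ hj)
      simp [this]
  · have : e k ∈ LinearMap.ker (e.coord k) := h ▸ Submodule.mem_top
    simp at this

/-- An equi-affine invariant valuation vanishing at points is a Cauchy function of the volume. -/
theorem IsPolytopeValuation.exists_cauchyFunction [Nontrivial E] {W : Set E → ℝ}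
    (hV : IsPolytopeValuation W) (hW : IsEquiAffineInvariant W) (h0 : W {0} = 0) (he : W ∅ = 0) :
    ∃ ζ : ℝ≥0 → ℝ, IsCauchyFunction ζ ∧ ∀ P, IsPolytope P → W P = ζ (μ P).toNNReal := by
  classical
  set e := Module.finBasis ℝ E
  have hn : 0 < Module.finrank ℝ E := Module.finrank_pos
  set i : Fin (Module.finrank ℝ E) := ⟨0, hn⟩
  set h : ℝ → ℝ := fun a => W (axisSimplex e i (Finset.univ.erase i) 0 a) with hh
  set v : ℝ≥0 := (μ (cornerSimplex e Finset.univ)).toNNReal with hvdef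
  have hfin : ∀ {S : Set E}, IsPolytope S → μ S ≠ ∞ := fun hS => hS.isCompact.measure_lt_top.ne
  have hvμ : (v : ℝ≥0∞) = μ (cornerSimplex e Finset.univ) :=
    ENNReal.coe_toNNReal (hfin (isPolytope_cornerSimplex _ _))
  have hv0 : v ≠ 0 := fun h => by
    have := measure_cornerSimplex_univ_pos μ e
    rw [← hvμ, h] at this
    simp at this
  have hadd : ∀ {a b : ℝ}, 0 ≤ a → 0 ≤ b → h (a + b) = h a + h b := fun ha hb =>
    hV.axisSimplex_add hW h0 e i ha hb
  -- `h` measures volume in units of the full corner simplex, whose volume is `v`.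
  set ζ : ℝ≥0 → ℝ := fun x => h ((x / v : ℝ≥0) : ℝ) with hζ
  have hζc : IsCauchyFunction ζ := fun x y => by
    simp only [hζ, add_div, NNReal.coe_add]
    exact hadd (NNReal.coe_nonneg _) (NNReal.coe_nonneg _)
  have hζ0 : ζ 0 = 0 := by
    have := hζc 0 0
    rw [add_zero] at this
    linarith
  refine ⟨ζ, hζc, fun P hP => ?_⟩
  have hVal : IsPolytopeValuation fun S => W S - ζ (μ S).toNNReal := by
    intro P Q hP hQ hU hI
    have h1 := hV P Q hP hQ hU hI
    have h2 : ζ (μ P).toNNReal + ζ (μ Q).toNNReal =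
        ζ (μ (P ∪ Q)).toNNReal + ζ (μ (P ∩ Q)).toNNReal := by
      rw [← hζc, ← hζc, ← ENNReal.toNNReal_add (hfin hP) (hfin hQ),
        ← ENNReal.toNNReal_add (hfin hU) (hfin hI),
        measure_union_add_inter P hQ.isCompact.isClosed.measurableSet]
    simp only
    linarith
  refine sub_eq_zero.1 (hVal.eq_zero (fun k w hw => ?_) hP)
  cases k with
  | zero => simp [he, hζ0]
  | succ k =>
    obtain ⟨J, A, x, hA, hJ⟩ := exists_cornerSimplex_image e w hw
    simp only
    rw [hJ, measure_affine_image, sub_eq_zero]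
    -- A full simplex has volume `|det A| * v`, which matches its value by the choice of `ζ`; for a
    -- proper face both the value and the volume are zero.
    by_cases hJu : J = Finset.univ
    · subst hJu
      have h1 : cornerSimplex e Finset.univ = axisSimplex e i (Finset.univ.erase i) 0 1 := by
        rw [axisSimplex_zero_one, Finset.insert_erase (Finset.mem_univ i)]
      rw [ENNReal.toNNReal_mul, ← hvdef, h1,
        hW.image_axisSimplex e (Finset.notMem_erase _ _) A hA, ← hW.axisSimplex_abs]
      simp only [hζ, hh]
      rw [mul_div_cancel_right₀ _ hv0]
      congr 2
      simp [ENNReal.ofReal]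
    · obtain ⟨j, hj⟩ : ∃ j, j ∉ J := by
        by_contra! h
        exact hJu (Finset.eq_univ_iff_forall.2 h)
      rw [hW.image_cornerSimplex e hj A hA, hV.cornerSimplex_eq_zero hW h0 e J hJu,
        measure_cornerSimplex_eq_zero μ e hj]
      simp [hζ0]

end Volume

/-! ### Continuity of the volume and properties of `ConvexPolytope` -/

/-- If a convex body contains a ball of radius `r` about `p` and is within distance `δ` of another
one, then shrinking it about `p` by `1 - δ / r` moves it inside the latter. -/
theorem homothety_mem_of_dist_le {E : Type*} [NormedAddCommGroup E] [InnerProductSpace ℝ E]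
    [CompleteSpace E] {P Q : Set E} (hQ : Convex ℝ Q) (hQc : IsClosed Q) {p : E} {r δ : ℝ}
    (hr : 0 < r) (hδ : 0 ≤ δ) (hδr : δ ≤ r) (hp : Metric.closedBall p r ⊆ P)
    (hPQ : ∀ x ∈ P, ∃ y ∈ Q, dist x y ≤ δ) {q : E} (hq : q ∈ P) :
    AffineMap.homothety p (1 - δ / r) q ∈ Q := by
  by_contra hx
  obtain ⟨f, u, hfu, hux⟩ := geometric_hahn_banach_closed_point hQ hQc hx
  set w := (InnerProductSpace.toDual ℝ E).symm f with hw
  have hfw : ∀ v, f v = inner ℝ w v := fun v => by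
    rw [hw, InnerProductSpace.toDual_symm_apply]
  have hle : ∀ x ∈ P, f x ≤ u + δ * ‖w‖ := fun x hx => by
    obtain ⟨y, hy, hxy⟩ := hPQ x hx
    have h1 : f x - f y ≤ ‖w‖ * δ := by
      rw [← map_sub, hfw]
      refine (real_inner_le_norm _ _).trans ?_
      rw [dist_eq_norm] at hxy
      gcongr
    have := hfu y hy
    linarith
  -- The bound `hle` at the point of the ball farthest in direction `w`. This gain of `r * ‖w‖`,
  -- weighted by `δ / r`, exactly cancels the loss `δ * ‖w‖`.
  have hfp : f p + r * ‖w‖ ≤ u + δ * ‖w‖ := by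
    by_cases hw0 : w = 0
    · have := hle p (hp (Metric.mem_closedBall_self hr.le))
      simpa [hw0] using this
    have hn : 0 < ‖w‖ := norm_pos_iff.2 hw0
    have := hle (p + (r / ‖w‖) • w) (hp (by
      rw [Metric.mem_closedBall, dist_eq_norm, add_sub_cancel_left, norm_smul,
        Real.norm_of_nonneg (by positivity), div_mul_cancel₀ _ hn.ne']))
    rw [map_add, map_smul, hfw w, real_inner_self_eq_norm_sq, smul_eq_mul] at this
    have h2 : r / ‖w‖ * ‖w‖ ^ 2 = r * ‖w‖ := by field_simp
    linarith
  have hfx : f (AffineMap.homothety p (1 - δ / r) q) = (1 - δ / r) * f q + δ / r * f p := by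
    rw [AffineMap.homothety_apply, vsub_eq_sub, vadd_eq_add, map_add, map_smul, map_sub,
      smul_eq_mul]
    ring
  rw [hfx] at hux
  have h1 : 0 ≤ 1 - δ / r := sub_nonneg.2 ((div_le_one hr).2 hδr)
  have h2 : 0 ≤ δ / r := by positivity
  have h3 := mul_le_mul_of_nonneg_left (hle q hq) h1
  have h4 := mul_le_mul_of_nonneg_left hfp h2
  have h5 : δ / r * (r * ‖w‖) = δ * ‖w‖ := by field_simp
  nlinarith

namespace ConvexPolytope

variable {n : ℕ}

theorem isPolytope (P : ConvexPolytope n) :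
    IsPolytope (P : Set (EuclideanSpace ℝ (Fin n))) := P.isHull'

theorem coe_vol (P : ConvexPolytope n) :
    (P.vol : ℝ) = volume.real (P : Set (EuclideanSpace ℝ (Fin n))) := rfl

theorem hausdorffEDist_ne_top (P Q : ConvexPolytope n) :
    Metric.hausdorffEDist (P : Set (EuclideanSpace ℝ (Fin n))) (Q : Set _) ≠ ⊤ :=
  Metric.hausdorffEDist_ne_top_of_nonempty_of_bounded P.nonempty Q.nonempty P.isCompact.isBounded
    Q.isCompact.isBounded

theorem exists_dist_le_hausdorffDist (P Q : ConvexPolytope n) {x : EuclideanSpace ℝ (Fin n)}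
    (hx : x ∈ P) : ∃ y ∈ Q, dist x y ≤ Metric.hausdorffDist (P : Set (EuclideanSpace ℝ (Fin n))) Q := by
  obtain ⟨y, hy, hxy⟩ := Q.isCompact.exists_infDist_eq_dist Q.nonempty x
  exact ⟨y, hy, hxy ▸ Metric.infDist_le_hausdorffDist_of_mem hx (hausdorffEDist_ne_top P Q)⟩

theorem tendsto_nhds_iff {α : Type*} {l : Filter α} {f : α → ConvexPolytope n}
    {P : ConvexPolytope n} : Tendsto f l (𝓝 P) ↔
      Tendsto (fun a => Metric.hausdorffDist (f a : Set (EuclideanSpace ℝ (Fin n))) P) l (𝓝 0) := by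
  rw [nhds_induced, tendsto_comap_iff, tendsto_iff_dist_tendsto_zero]
  rfl

/-- The volume is continuous in the Hausdorff metric. -/
theorem continuous_vol : Continuous fun P : ConvexPolytope n => (P.vol : ℝ) := by
  rw [continuous_iff_continuousAt]
  intro P
  set δ : ConvexPolytope n → ℝ := fun Q =>
    Metric.hausdorffDist (Q : Set (EuclideanSpace ℝ (Fin n))) P with hδ
  have hδ0 : ∀ Q, 0 ≤ δ Q := fun Q => Metric.hausdorffDist_nonneg
  have hδt : Tendsto δ (𝓝 P) (𝓝 0) := tendsto_nhds_iff.1 tendsto_id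
  have hup : Tendsto (fun Q => volume.real
      (Metric.cthickening (δ Q) (P : Set (EuclideanSpace ℝ (Fin n))))) (𝓝 P) (𝓝 (P.vol : ℝ)) :=
    (ENNReal.tendsto_toReal P.isCompact.measure_lt_top.ne).comp
      ((tendsto_measure_cthickening_of_isCompact P.isCompact).comp hδt)
  have hle : ∀ Q : ConvexPolytope n, (Q.vol : ℝ) ≤ volume.real
      (Metric.cthickening (δ Q) (P : Set (EuclideanSpace ℝ (Fin n)))) := fun Q => by
    refine measureReal_mono (fun x hx => ?_)
      (Metric.isCompact_of_isClosed_isBounded Metric.isClosed_cthickening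
        P.isCompact.isBounded.cthickening).measure_lt_top.ne
    obtain ⟨y, hy, hxy⟩ := exists_dist_le_hausdorffDist Q P hx
    exact Metric.mem_cthickening_of_dist_le x y _ _ hy hxy
  by_cases hi : (interior (P : Set (EuclideanSpace ℝ (Fin n)))).Nonempty
  · obtain ⟨p, hp⟩ := hi
    obtain ⟨r, hr, hrP⟩ := Metric.nhds_basis_closedBall.mem_iff.1 (mem_interior_iff_mem_nhds.1 hp)
    -- A polytope `Q` near `P` contains a copy of `P` shrunk by `1 - δ Q / r`, which bounds its
    -- volume from below. Without interior points `P` has volume `0`, and the upper bound suffices.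
    have hlow : Tendsto (fun Q => |(1 - δ Q / r) ^ n| * (P.vol : ℝ)) (𝓝 P) (𝓝 (P.vol : ℝ)) := by
      simpa using ((((hδt.div_const r).const_sub 1).pow n).abs).mul_const (P.vol : ℝ)
    refine tendsto_of_tendsto_of_tendsto_of_le_of_le' hlow hup ?_ (Eventually.of_forall hle)
    filter_upwards [hδt.eventually_le_const hr] with Q hQ
    have h1 : AffineMap.homothety p (1 - δ Q / r) '' (P : Set (EuclideanSpace ℝ (Fin n))) ⊆ Q := by
      rintro _ ⟨q, hq, rfl⟩
      refine homothety_mem_of_dist_le Q.isPolytope.convex Q.isCompact.isClosed hr (hδ0 Q) hQ hrP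
        (fun x hx => ?_) hq
      have := exists_dist_le_hausdorffDist P Q hx
      rwa [Metric.hausdorffDist_comm] at this
    have h2 := measureReal_mono h1 Q.isCompact.measure_lt_top.ne (μ := volume)
    rw [Measure.real, Measure.addHaar_image_homothety, ENNReal.toReal_mul,
      ENNReal.toReal_ofReal (abs_nonneg _), finrank_euclideanSpace_fin] at h2
    exact h2
  · have h0 : (P.vol : ℝ) = 0 := by
      have h1 : volume (P : Set (EuclideanSpace ℝ (Fin n))) = 0 := by
        refine measure_mono_null ?_ (P.isPolytope.convex.addHaar_frontier volume)
        rw [P.isCompact.isClosed.frontier_eq, Set.not_nonempty_iff_eq_empty.1 hi, Set.sdiff_empty]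
      rw [coe_vol, Measure.real, h1, ENNReal.toReal_zero]
    rw [ContinuousAt, h0]
    rw [h0] at hup
    exact squeeze_zero (fun Q => NNReal.coe_nonneg _) hle hup

/-- The dilate `a P`. -/
noncomputable def dilate (a : ℝ) (P : ConvexPolytope n) : ConvexPolytope n :=
  P.map (a • LinearMap.id : EuclideanSpace ℝ (Fin n) →ₗ[ℝ] EuclideanSpace ℝ (Fin n)).toAffineMap

theorem coe_dilate (a : ℝ) (P : ConvexPolytope n) :
    (P.dilate a : Set (EuclideanSpace ℝ (Fin n))) = a • (P : Set _) := rfl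

theorem vol_dilate {a : ℝ≥0} (P : ConvexPolytope n) : (P.dilate a).vol = a ^ n * P.vol := by
  rw [vol, coe_dilate, Measure.addHaar_smul, ENNReal.toNNReal_mul, finrank_euclideanSpace_fin, vol,
    abs_of_nonneg (by positivity)]
  congr 1
  rw [← NNReal.coe_pow, ENNReal.ofReal_coe_nnreal, ENNReal.toNNReal_coe]

theorem tendsto_dilate_zero (P : ConvexPolytope n) :
    Tendsto (fun a : ℝ => P.dilate a) (𝓝 0) (𝓝 (P.dilate 0)) := by
  rw [tendsto_nhds_iff]
  obtain ⟨R, hR0, hR⟩ := P.isCompact.isBounded.subset_closedBall_lt 0 (0 : EuclideanSpace ℝ (Fin n))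
  have hlim : Tendsto (fun a : ℝ => |a| * R) (𝓝 0) (𝓝 0) := by
    have h : Continuous fun a : ℝ => |a| * R := continuous_abs.mul continuous_const
    simpa using h.tendsto 0
  refine squeeze_zero (fun _ => Metric.hausdorffDist_nonneg) (fun a => ?_) hlim
  have hd : ∀ x ∈ P, dist (a • x) ((0 : ℝ) • x) ≤ |a| * R := fun x hx => by
    have := hR hx
    rw [mem_closedBall_zero_iff] at this
    rw [zero_smul, dist_zero_right, norm_smul, Real.norm_eq_abs]
    gcongr
  refine Metric.hausdorffDist_le_of_mem_dist (by positivity) ?_ ?_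
  · rintro _ ⟨x, hx, rfl⟩
    exact ⟨(0 : ℝ) • x, ⟨x, hx, rfl⟩, hd x hx⟩
  · rintro _ ⟨x, hx, rfl⟩
    refine ⟨a • x, ⟨x, hx, rfl⟩, ?_⟩
    rw [dist_comm]
    exact hd x hx

theorem exists_vol_pos : ∃ P : ConvexPolytope n, 0 < P.vol := by
  classical
  set e := (EuclideanSpace.basisFun (Fin n) ℝ).toBasis
  have hp := isPolytope_cornerSimplex e Finset.univ
  have hv := measure_cornerSimplex_univ_pos (volume : Measure (EuclideanSpace ℝ (Fin n))) e
  refine ⟨⟨cornerSimplex e Finset.univ, nonempty_of_measure_ne_zero hv.ne', hp⟩, ?_⟩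
  exact ENNReal.toNNReal_pos hv.ne' hp.isCompact.measure_lt_top.ne

/-- A convex set is connected, so it is no union of two disjoint non-empty closed sets. The clause
of `IsValuation` for empty intersections is therefore vacuous. -/
theorem not_disjoint_of_coe_union {P Q U : ConvexPolytope n}
    (hU : (U : Set (EuclideanSpace ℝ (Fin n))) = (P : Set _) ∪ (Q : Set _)) :
    (P : Set (EuclideanSpace ℝ (Fin n))) ∩ (Q : Set _) ≠ ∅ := by
  have h := isPreconnected_closed_iff.1 U.isPolytope.convex.isPreconnected P Q
    P.isCompact.isClosed Q.isCompact.isClosed hU.subset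
  rw [hU] at h
  obtain ⟨p, hp⟩ := P.nonempty
  obtain ⟨q, hq⟩ := Q.nonempty
  obtain ⟨x, -, hx⟩ := h ⟨p, Or.inl hp, hp⟩ ⟨q, Or.inr hq, hq⟩
  exact Set.nonempty_iff_ne_empty.1 ⟨x, hx⟩

theorem isValuation_of_cauchyFunction (c₀ : ℝ) {ζ : ℝ≥0 → ℝ} (hζ : IsCauchyFunction ζ) :
    IsValuation fun P : ConvexPolytope n => c₀ * P.eulerChar + ζ P.vol := by
  refine ⟨fun P Q U I hU hI => ?_, fun P Q U hU h => absurd h (not_disjoint_of_coe_union hU)⟩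
  have h : ζ P.vol + ζ Q.vol = ζ U.vol + ζ I.vol := by
    have hfin := fun P : ConvexPolytope n => P.isCompact.measure_lt_top (μ := volume).ne
    rw [← hζ, ← hζ, vol, vol, vol, vol, ← ENNReal.toNNReal_add (hfin P) (hfin Q),
      ← ENNReal.toNNReal_add (hfin U) (hfin I), hU, hI,
      measure_union_add_inter _ Q.isCompact.isClosed.measurableSet]
  simp only [eulerChar_eq_one]
  linarith

theorem vol_translate (x : EuclideanSpace ℝ (Fin n)) (P : ConvexPolytope n) :
    (P.translate x).vol = P.vol := by
  rw [vol, coe_translate, Set.image_add_left, measure_preimage_add, vol]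

theorem det_toEuclideanLin (M : Matrix (Fin n) (Fin n) ℝ) :
    LinearMap.det (Matrix.toEuclideanLin M) = M.det := by
  rw [Matrix.toEuclideanLin, Matrix.toLpLin_eq_toLin, LinearMap.det_toLin]

theorem vol_slImage (φ : Matrix.SpecialLinearGroup (Fin n) ℝ) (P : ConvexPolytope n) :
    (P.slImage φ).vol = P.vol := by
  rw [vol, coe_slImage, Measure.addHaar_image_linearMap, det_toEuclideanLin, φ.det_coe, vol]
  simp

/-- The extension of `Z - c` to all sets, zero outside non-empty polytopes. -/
noncomputable def normalizedExtension (Z : ConvexPolytope n → ℝ) (c : ℝ)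
    (S : Set (EuclideanSpace ℝ (Fin n))) : ℝ :=
  open Classical in
  if h : S.Nonempty ∧ IsPolytope S then Z ⟨S, h.1, h.2⟩ - c else 0

theorem normalizedExtension_coe (Z : ConvexPolytope n → ℝ) (c : ℝ) (P : ConvexPolytope n) :
    normalizedExtension Z c P = Z P - c := by
  rw [normalizedExtension, dif_pos ⟨P.nonempty, P.isPolytope⟩]
  rfl

theorem normalizedExtension_empty (Z : ConvexPolytope n → ℝ) (c : ℝ) :
    normalizedExtension Z c ∅ = 0 := by
  rw [normalizedExtension, dif_neg (by simp)]

theorem exists_coe_eq {S : Set (EuclideanSpace ℝ (Fin n))} (h : IsPolytope S) (hne : S.Nonempty) :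
    ∃ P : ConvexPolytope n, (P : Set (EuclideanSpace ℝ (Fin n))) = S :=
  ⟨⟨S, hne, h⟩, rfl⟩

theorem IsValuation.isPolytopeValuation {Z : ConvexPolytope n → ℝ} (hZ : IsValuation Z) (c : ℝ) :
    IsPolytopeValuation (normalizedExtension Z c) := by
  intro P Q hP hQ hU hI
  rcases P.eq_empty_or_nonempty with rfl | hPne
  · simp [normalizedExtension_empty]
  rcases Q.eq_empty_or_nonempty with rfl | hQne
  · simp [normalizedExtension_empty]
  obtain ⟨U, hU'⟩ := exists_coe_eq hU (hPne.mono Set.subset_union_left)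
  obtain ⟨P, rfl⟩ := exists_coe_eq hP hPne
  obtain ⟨Q, rfl⟩ := exists_coe_eq hQ hQne
  obtain ⟨I, hI'⟩ := exists_coe_eq hI
    (Set.nonempty_iff_ne_empty.2 (not_disjoint_of_coe_union hU'))
  rw [← hU', ← hI', normalizedExtension_coe, normalizedExtension_coe, normalizedExtension_coe,
    normalizedExtension_coe]
  linarith [hZ.1 P Q U I hU' hI']

theorem IsSLInvariant.isEquiAffineInvariant {Z : ConvexPolytope n → ℝ} (hT : IsTranslationInvariant Z)
    (hZ : IsSLInvariant Z) (c : ℝ) : IsEquiAffineInvariant (normalizedExtension Z c) := by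
  intro φ hφ x S hS
  rcases S.eq_empty_or_nonempty with rfl | hne
  · rw [Set.image_empty]
  obtain ⟨P, rfl⟩ := exists_coe_eq hS hne
  obtain ⟨M, rfl⟩ := Matrix.toEuclideanLin.surjective φ
  rw [det_toEuclideanLin] at hφ
  obtain ⟨ψ, rfl⟩ : ∃ ψ : Matrix.SpecialLinearGroup (Fin n) ℝ,
      (ψ : Matrix (Fin n) (Fin n) ℝ) = M := ⟨⟨M, hφ⟩, rfl⟩
  have h : ((Matrix.toEuclideanLin (ψ : Matrix (Fin n) (Fin n) ℝ)).toAffineMap + AffineMap.const ℝ (EuclideanSpace ℝ (Fin n)) x) ''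
      (P : Set (EuclideanSpace ℝ (Fin n))) =
      ((P.slImage ψ).translate x : Set (EuclideanSpace ℝ (Fin n))) := by
    rw [coe_translate, coe_slImage, Set.image_image]
    exact Set.image_congr fun y _ => add_comm _ _
  rw [h, normalizedExtension_coe, normalizedExtension_coe, hT, hZ]

end ConvexPolytope

/-! ### Linearity under continuity, and the classification -/

/-- A Cauchy function tending to zero at zero is linear. -/
theorem IsCauchyFunction.exists_eq_mul {ζ : ℝ≥0 → ℝ} (hζ : IsCauchyFunction ζ)
    (hlim : Tendsto ζ (𝓝 0) (𝓝 0)) : ∃ c : ℝ, ∀ x, ζ x = c * x := by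
  have h0 : ζ 0 = 0 := by
    have := hζ 0 0
    rw [add_zero] at this
    linarith
  have hsum : ∀ x y : ℝ, (x + y).toNNReal + ((-x).toNNReal + (-y).toNNReal) =
      (-(x + y)).toNNReal + (x.toNNReal + y.toNNReal) := fun x y => by
    have h := fun a : ℝ => max_zero_sub_max_neg_zero_eq_self a
    ext
    simp only [NNReal.coe_add, Real.coe_toNNReal']
    linarith [h x, h y, h (x + y), max_comm x 0]
  -- The odd extension of `ζ` to the real line. It is additive by `hsum`, an identity of positive
  -- and negative parts written without subtraction, and continuity at `0` then gives linearity.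
  set ψ : ℝ →+ ℝ := AddMonoidHom.mk' (fun x => ζ x.toNNReal - ζ (-x).toNNReal) fun x y => by
    have := congrArg ζ (hsum x y)
    rw [hζ, hζ, hζ, hζ] at this
    linarith with hψ
  have hψa : ∀ x, ψ x = ζ x.toNNReal - ζ (-x).toNNReal := fun _ => rfl
  have hcont : Continuous ψ := by
    refine continuous_of_continuousAt_zero ψ ?_
    rw [ContinuousAt, map_zero]
    have h1 : Tendsto (fun x : ℝ => ζ x.toNNReal) (𝓝 0) (𝓝 0) := by
      refine hlim.comp ?_
      simpa using continuous_real_toNNReal.tendsto 0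
    have h2 : Tendsto (fun x : ℝ => ζ (-x).toNNReal) (𝓝 0) (𝓝 0) := by
      refine h1.comp ?_
      simpa using (continuous_neg (G := ℝ)).tendsto 0
    have h3 := h1.sub h2
    rw [sub_zero] at h3
    exact h3
  refine ⟨ψ 1, fun x => ?_⟩
  have h1 := map_real_smul ψ hcont (x : ℝ) 1
  rw [smul_eq_mul, mul_one, smul_eq_mul, hψa] at h1
  rw [mul_comm, ← h1, Real.toNNReal_coe, Real.toNNReal_of_nonpos (neg_nonpos.2 x.coe_nonneg), h0,
    sub_zero]

theorem IsCauchyFunction.const_mul (c : ℝ) : IsCauchyFunction fun x => c * (x : ℝ) := fun x y => by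
  simp only [NNReal.coe_add, mul_add]

namespace ConvexPolytope

theorem eq_of_zero_dim (P Q : ConvexPolytope 0) : P = Q := by
  refine SetLike.coe_injective ?_
  obtain ⟨p, hp⟩ := P.nonempty
  obtain ⟨q, hq⟩ := Q.nonempty
  ext x
  exact ⟨fun _ => Subsingleton.elim q x ▸ hq, fun _ => Subsingleton.elim p x ▸ hp⟩

theorem exists_cauchyFunction {n : ℕ} {Z : ConvexPolytope n → ℝ} (hV : IsValuation Z)
    (hT : IsTranslationInvariant Z) (hZ : IsSLInvariant Z) :
    ∃ (c₀ : ℝ) (ζ : ℝ≥0 → ℝ), IsCauchyFunction ζ ∧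
      ∀ P : ConvexPolytope n, Z P = c₀ * P.eulerChar + ζ P.vol := by
  obtain ⟨O, hO⟩ := exists_coe_eq (IsPolytope.singleton (0 : EuclideanSpace ℝ (Fin n)))
    (Set.singleton_nonempty 0)
  rcases n.eq_zero_or_pos with rfl | hn
  -- In dimension zero the point is the only polytope, so the constant term alone suffices.
  · refine ⟨Z O, fun _ => 0, fun x y => by simp, fun P => ?_⟩
    rw [eq_of_zero_dim P O, eulerChar_eq_one]
    simp
  · have : Nontrivial (EuclideanSpace ℝ (Fin n)) := by
      have : Nonempty (Fin n) := ⟨⟨0, hn⟩⟩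
      infer_instance
    obtain ⟨ζ, hζ, h⟩ := (hV.isPolytopeValuation (Z O)).exists_cauchyFunction volume
      (hZ.isEquiAffineInvariant hT (Z O)) (by rw [← hO, normalizedExtension_coe, sub_self])
      (normalizedExtension_empty Z _)
    refine ⟨Z O, ζ, hζ, fun P => ?_⟩
    have := h P P.isPolytope
    rw [normalizedExtension_coe] at this
    rw [eulerChar_eq_one, vol]
    linarith

theorem exists_eq_mul_vol {n : ℕ} {Z : ConvexPolytope n → ℝ} (hc : Continuous Z) {c₀ : ℝ}
    {ζ : ℝ≥0 → ℝ} (hζ : IsCauchyFunction ζ)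
    (h : ∀ P : ConvexPolytope n, Z P = c₀ * P.eulerChar + ζ P.vol) :
    ∃ c₀ c : ℝ, ∀ P : ConvexPolytope n, Z P = c₀ * P.eulerChar + c * (P.vol : ℝ) := by
  obtain ⟨P, hP⟩ := exists_vol_pos (n := n)
  rcases n.eq_zero_or_pos with rfl | hn
  · refine ⟨Z P, 0, fun Q => ?_⟩
    rw [eq_of_zero_dim Q P, eulerChar_eq_one]
    simp
  have hn0 : (n : ℝ) ≠ 0 := Nat.cast_ne_zero.2 hn.ne'
  -- The dilation factor for which the dilate of `P` has volume exactly `x`. It tends to `0` with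
  -- `x`, so continuity of `Z` at the point `P.dilate 0` controls `ζ` near `0`.
  set a : ℝ≥0 → ℝ≥0 := fun x => (x / P.vol) ^ (n : ℝ)⁻¹ with ha
  have ha0 : a 0 = 0 := by
    rw [ha]
    simp only [zero_div]
    exact NNReal.zero_rpow (inv_ne_zero hn0)
  have hat : Tendsto (fun x => (a x : ℝ)) (𝓝 0) (𝓝 0) := by
    have h1 : Continuous fun x => (a x : ℝ) := NNReal.continuous_coe.comp
      ((NNReal.continuous_rpow_const (by positivity)).comp (continuous_id.div_const _))
    simpa [ha0] using h1.tendsto 0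
  have hvol : ∀ x, (P.dilate (a x)).vol = x := fun x => by
    rw [vol_dilate, ha]
    simp only
    rw [NNReal.rpow_inv_natCast_pow _ hn.ne', div_mul_cancel₀ _ hP.ne']
  have hlim : Tendsto ζ (𝓝 0) (𝓝 0) := by
    have h0 : ζ 0 = 0 := by
      have := hζ 0 0
      rw [add_zero] at this
      linarith
    have h1 : ∀ x, ζ x = Z (P.dilate (a x)) - c₀ := fun x => by
      rw [h, hvol, eulerChar_eq_one]
      ring
    have h2 : Tendsto (fun x => Z (P.dilate (a x)) - c₀) (𝓝 0) (𝓝 (Z (P.dilate 0) - c₀)) :=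
      ((hc.tendsto _).comp (P.tendsto_dilate_zero.comp hat)).sub_const c₀
    have h3 : Z (P.dilate 0) - c₀ = 0 := by
      have := h1 0
      rw [ha0, NNReal.coe_zero, h0] at this
      exact this.symm
    rw [h3] at h2
    exact h2.congr fun x => (h1 x).symm
  obtain ⟨c, hcx⟩ := hζ.exists_eq_mul hlim
  exact ⟨c₀, c, fun Q => by rw [h, hcx]⟩

end ConvexPolytope

theorem mainTheorem2 (n : ℕ) (Z : ConvexPolytope n → ℝ) :
    ((ConvexPolytope.IsValuation Z ∧ ConvexPolytope.IsTranslationInvariant Z ∧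
        ConvexPolytope.IsSLInvariant Z) ↔
      ∃ (c₀ : ℝ) (ζ : ℝ≥0 → ℝ), IsCauchyFunction ζ ∧
        ∀ P : ConvexPolytope n, Z P = c₀ * P.eulerChar + ζ P.vol) ∧
    ((Continuous Z ∧ ConvexPolytope.IsValuation Z ∧ ConvexPolytope.IsTranslationInvariant Z ∧
        ConvexPolytope.IsSLInvariant Z) ↔
      ∃ c₀ cₙ : ℝ, ∀ P : ConvexPolytope n, Z P = c₀ * P.eulerChar + cₙ * (P.vol : ℝ)) := by
  have hconv : ∀ (c₀ : ℝ) (ζ : ℝ≥0 → ℝ), IsCauchyFunction ζ →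
      (∀ P : ConvexPolytope n, Z P = c₀ * P.eulerChar + ζ P.vol) →
      ConvexPolytope.IsValuation Z ∧ ConvexPolytope.IsTranslationInvariant Z ∧
        ConvexPolytope.IsSLInvariant Z := by
    intro c₀ ζ hζ h
    obtain rfl : Z = fun P => c₀ * P.eulerChar + ζ P.vol := funext h
    refine ⟨ConvexPolytope.isValuation_of_cauchyFunction c₀ hζ, fun x P => ?_, fun φ P => ?_⟩
    · simp only [ConvexPolytope.eulerChar_eq_one, ConvexPolytope.vol_translate]
    · simp only [ConvexPolytope.eulerChar_eq_one, ConvexPolytope.vol_slImage]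
  refine ⟨⟨fun ⟨hV, hT, hS⟩ => ConvexPolytope.exists_cauchyFunction hV hT hS,
    fun ⟨c₀, ζ, hζ, h⟩ => hconv c₀ ζ hζ h⟩, ⟨fun ⟨hc, hV, hT, hS⟩ => ?_, fun ⟨c₀, c, h⟩ => ⟨?_, ?_⟩⟩⟩
  · obtain ⟨c₀, ζ, hζ, h⟩ := ConvexPolytope.exists_cauchyFunction hV hT hS
    exact ConvexPolytope.exists_eq_mul_vol hc hζ h
  · obtain rfl : Z = fun P => c₀ * P.eulerChar + c * (P.vol : ℝ) := funext h
    simp only [ConvexPolytope.eulerChar_eq_one]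
    exact continuous_const.add (continuous_const.mul ConvexPolytope.continuous_vol)
  · exact hconv c₀ _ (IsCauchyFunction.const_mul c) h
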